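/- Let $G=\{(z+w,\,zw): z,w\in\mathbb C,\ |z|<1,\ |w|<1\}\subset\mathbb C^2$ be the symmetrized bidisc, and write $s=(s^1,s^2)$ for its points. Let the Schur class $\mathcal S(G)$ be the set of analytic functions $\varphi:G\to\mathbb C$ with $|\varphi(s)|\le 1$ for all $s\in G$. For a contraction $T$ on a complex Hilbert space $\mathcal M$ (that is, a bounded linear operator with $\|T\|\le 1$) and $s\in G$, put $$ s_T=(2s^2T-s^1)(2-s^1T)^{-1}, $$ where the inverse exists because $|s^1|<2$. A $G$-model of a function $\varphi:G\to\mathbb C$ is a triple $(\mathcal M,T,u)$ in which $\mathcal M$ is a complex Hilbert space, $T$ is a contraction on $\mathcal M$ and $u:G\to\mathcal M$ is an analytic function such that, for all $s,t\in G$, $$ 1-\overline{\varphi(t)}\,\varphi(s)=\big\langle (1-t_T^*\,s_T)\,u(s),\,u(t)\big\rangle_{\mathcal M}, $$ the inner product being linear in its first argument. **Theorem.** Let $\varphi:G\to\mathbb C$ be a function. The following three statements are equivalent: 1. $\varphi\in\mathcal S(G)$; 2. $\varphi$ has a $G$-model; 3. $\varphi$ has a $G$-model $(\mathcal M,T,u)$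 in which $T$ is a unitary operator on $\mathcal M$. -/

import Mathlib

/-!
The symmetrized bidisc, its Schur class, and Hilbert space models on it.

A point of the domain is a pair `s = (s.1, s.2) : ℂ × ℂ`. A function on the domain is represented
by a total function on `ℂ × ℂ` of which only the values on the domain are ever used: the domain
is open, so that analyticity on it, too, depends on these values only.
-/

universe u

namespace SymBidisc

open scoped ComplexConjugate

/-- The symmetrized bidisc `G = {(z + w, z w) : |z| < 1, |w| < 1}`. -/
def G : Set (ℂ × ℂ) :=
  {s | ∃ z w : ℂ, ‖z‖ < 1 ∧ ‖w‖ < 1 ∧ s = (z + w, z * w)}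

/-- The Schur class of `G`: analytic functions on `G` bounded by `1` in modulus. -/
def SchurClass : Set (ℂ × ℂ → ℂ) :=
  {φ | AnalyticOnNhd ℂ φ G ∧ ∀ s ∈ G, ‖φ s‖ ≤ 1}

section Model

variable {M : Type*} [NormedAddCommGroup M] [InnerProductSpace ℂ M]

/-- The operator `s_T = (2 s² T - s¹) (2 - s¹ T)⁻¹`, where `s¹, s²` are the coordinates of `s`.
For `s ∈ G` and `T` a contraction, `‖s¹ T‖ < 2`, so that `2 - s¹ T` is invertible
and `Ring.inverse` is its actual inverse. -/
noncomputable def opAt (s : ℂ × ℂ) (T : M →L[ℂ] M) : M →L[ℂ] M :=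
  ((2 * s.2) • T - s.1 • (1 : M →L[ℂ] M)) *
    Ring.inverse ((2 : ℂ) • (1 : M →L[ℂ] M) - s.1 • T)

/-- `(M, T, u)` is a `G`-model of `φ`: `T` is a contraction on the Hilbert space `M`, `u : G → M`
is analytic, and `1 - conj (φ t) φ s = ⟨(1 - t_T^* s_T) u(s), u(t)⟩` for `s, t ∈ G`, where
`⟨·, ·⟩` is linear in its first variable (Mathlib's `inner` is linear in its second one). -/
structure IsGModel [CompleteSpace M] (φ : ℂ × ℂ → ℂ) (T : M →L[ℂ] M) (u : ℂ × ℂ → M) :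
    Prop where
  contraction : ‖T‖ ≤ 1
  analytic : AnalyticOnNhd ℂ u G
  model : ∀ s ∈ G, ∀ t ∈ G,
    1 - conj (φ t) * φ s =
      inner ℂ (u t) ((1 - ContinuousLinearMap.adjoint (opAt t T) * opAt s T) (u s))

end Model

/-- `φ` has a `G`-model. -/
def HasGModel (φ : ℂ × ℂ → ℂ) : Prop :=
  ∃ (M : Type u) (_ : NormedAddCommGroup M) (_ : InnerProductSpace ℂ M) (_ : CompleteSpace M)
    (T : M →L[ℂ] M) (u : ℂ × ℂ → M), IsGModel φ T u

/-- `φ` has a `G`-model `(M, T, u)` in which `T` is a unitary operator on `M`. -/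
def HasUnitaryGModel (φ : ℂ × ℂ → ℂ) : Prop :=
  ∃ (M : Type u) (_ : NormedAddCommGroup M) (_ : InnerProductSpace ℂ M) (_ : CompleteSpace M)
    (T : M →L[ℂ] M) (u : ℂ × ℂ → M), IsGModel φ T u ∧ T ∈ unitary (M →L[ℂ] M)

end SymBidisc

/-! ### Geometry of the symmetrized bidisc. -/

namespace SymBidisc

open scoped ComplexConjugate

/-! A function with a model is Schur because s_T is a strict contraction for s ∈ G
(`norm_opAt_lt_one`): the model identity with s = t bounds φ, and with t fixed, φ(t) ≠ 0, it
expresses φ as an analytic function of s.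

Conversely, f(z, w) = φ(z + w, zw) is a symmetric Schur function on the bidisc. Agler's theorem
(`exists_agler_decomposition`), averaged over the swap of coordinates, gives a single v with 1 -
conj f(z', w') f(z, w) = (1 - conj z' z)⟨v(z, w), v(z', w')⟩ + (1 - conj w' w)⟨v(w, z), v(w', z')⟩.
Exchanging z' and w' does not change the left side. Subtracting, z v(z, w) - w v(w, z) and v(z, w) -
v(w, z) have the same Gram matrix, so a unitary T on a larger space carries the first family to the
second. Then v(z, w) = (1 - wT)x and v(w, z) = (1 - zT)x for a common x, and u(s) = (2 - s¹T)x/√2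
satisfies the model identity. A second lurking isometry shows u = (1 - D s_T)⁻¹C, which is analytic
(`hasUnitaryGModel_of_unitary`).

Agler's theorem is proved geometrically on ℓ²(ℤ²) with its shifts U₁, U₂. By von Neumann's
inequality for commuting unitaries, f^∨(U₁, U₂) exists as a contraction M, a weak limit of
polynomials; it dilates to the isometry J = (M, (1 - M*M)^{1/2}). Let H and L be the ℓ² spaces of
the quadrant and the half plane, X = H ⊕ ℓ²(ℤ²), and S the part of X orthogonal to JL. With k the
Szegő kernel, (k, 0) splits orthogonally into f·Jk, a vector p of S and a remainder d. The diagonal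
action of U₁ preserves S, and that of U₂ keeps d orthogonal to S and to JH; p and d yield the two
terms of the decomposition (`exists_decomposition`). -/

lemma norm_sub_conj_mul_lt {s : ℂ × ℂ} (hs : s ∈ G) :
    ‖s.1 - conj s.1 * s.2‖ < 1 - ‖s.2‖ ^ 2 := by
  obtain ⟨z, w, hz, hw, rfl⟩ := hs
  have h : (z + w) - conj (z + w) * (z * w) =
      ((1 - ‖w‖ ^ 2 : ℝ) : ℂ) * z + ((1 - ‖z‖ ^ 2 : ℝ) : ℂ) * w := by
    push_cast
    rw [← Complex.conj_mul', ← Complex.conj_mul', map_add]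
    ring
  have hz0 := norm_nonneg z
  have hw0 := norm_nonneg w
  have hz2 : 0 ≤ 1 - ‖z‖ ^ 2 := by nlinarith
  have hw2 : 0 ≤ 1 - ‖w‖ ^ 2 := by nlinarith
  calc ‖(z + w) - conj (z + w) * (z * w)‖
      ≤ (1 - ‖w‖ ^ 2) * ‖z‖ + (1 - ‖z‖ ^ 2) * ‖w‖ := by
        rw [h]
        refine (norm_add_le _ _).trans_eq ?_
        rw [norm_mul, norm_mul, Complex.norm_of_nonneg hz2, Complex.norm_of_nonneg hw2]
    -- The left side is (|z| + |w|)(1 - |zw|), and |z| + |w| < 1 + |zw| because (1 - |z|)(1 - |w|) >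
    -- 0.
    _ < 1 - ‖z * w‖ ^ 2 := by
        rw [norm_mul]
        have h1 : 0 < (1 - ‖z‖) * (1 - ‖w‖) := mul_pos (by linarith) (by linarith)
        have h2 : 0 < 1 - ‖z‖ * ‖w‖ := by nlinarith
        nlinarith [mul_pos h1 h2]

lemma exists_roots (s : ℂ × ℂ) : ∃ z w : ℂ, s = (z + w, z * w) := by
  obtain ⟨r, hr⟩ := IsAlgClosed.exists_pow_nat_eq (s.1 ^ 2 - 4 * s.2) (n := 2) (by norm_num)
  refine ⟨(s.1 + r) / 2, (s.1 - r) / 2, Prod.ext (by ring) ?_⟩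
  simp only
  linear_combination (1 / 4) * hr

/-- A strict inequality in s is what makes G visibly open. For the converse, if |z| ≥ 1, the
inequality forces |zw| < 1, hence |w| < 1, and the reverse triangle inequality yields (1 - |zw|)(1 -
|z|)(1 - |w|) > 0, which is impossible. -/
lemma mem_G_iff {s : ℂ × ℂ} : s ∈ G ↔ ‖s.1 - conj s.1 * s.2‖ < 1 - ‖s.2‖ ^ 2 := by
  refine ⟨norm_sub_conj_mul_lt, fun h ↦ ?_⟩
  obtain ⟨z, w, rfl⟩ := exists_roots s
  have key : ∀ z w : ℂ, ‖(z + w) - conj (z + w) * (z * w)‖ < 1 - ‖z * w‖ ^ 2 → ‖z‖ < 1 := by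
    intro z w h
    by_contra! hz
    have hw0 := norm_nonneg w
    have e : (z + w) - conj (z + w) * (z * w) =
        ((1 - ‖w‖ ^ 2 : ℝ) : ℂ) * z - ((‖z‖ ^ 2 - 1 : ℝ) : ℂ) * w := by
      push_cast
      rw [← Complex.conj_mul', ← Complex.conj_mul', map_add]
      ring
    have hab : ‖z‖ * ‖w‖ < 1 := by
      have h1 := (norm_nonneg _).trans_lt h
      rw [norm_mul] at h1
      nlinarith [mul_nonneg (norm_nonneg z) hw0]
    have hw : ‖w‖ < 1 := by nlinarith
    have hw2 : 0 ≤ 1 - ‖w‖ ^ 2 := by nlinarith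
    have hz2 : 0 ≤ ‖z‖ ^ 2 - 1 := by nlinarith
    have h2 := norm_sub_norm_le (((1 - ‖w‖ ^ 2 : ℝ) : ℂ) * z) (((‖z‖ ^ 2 - 1 : ℝ) : ℂ) * w)
    rw [← e, norm_mul, norm_mul, Complex.norm_of_nonneg hz2, Complex.norm_of_nonneg hw2] at h2
    have h3 := h2.trans_lt h
    rw [norm_mul] at h3
    have h4 : 0 < (1 - ‖z‖ * ‖w‖) * ((1 - ‖z‖) * (1 - ‖w‖)) := by nlinarith
    have h5 := pos_of_mul_pos_right h4 (by linarith)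
    nlinarith
  refine ⟨z, w, key z w h, key w z ?_, rfl⟩
  rw [add_comm, mul_comm w z]
  exact h

lemma isOpen_G : IsOpen G := by
  have : G = {s : ℂ × ℂ | ‖s.1 - conj s.1 * s.2‖ < 1 - ‖s.2‖ ^ 2} := by
    ext s
    exact mem_G_iff
  rw [this]
  exact isOpen_lt (by fun_prop) (by fun_prop)

lemma norm_fst_lt_two {s : ℂ × ℂ} (hs : s ∈ G) : ‖s.1‖ < 2 := by
  obtain ⟨z, w, hz, hw, rfl⟩ := hs
  exact (norm_add_le z w).trans_lt (by linarith)

lemma norm_fst_sq_le {s : ℂ × ℂ} (hs : s ∈ G) : ‖s.1‖ ^ 2 ≤ 2 + 2 * ‖s.2‖ ^ 2 := by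
  obtain ⟨z, w, hz, hw, rfl⟩ := hs
  have h1 := norm_add_le z w
  have h2 : 0 ≤ (1 - ‖z‖ ^ 2) * (1 - ‖w‖ ^ 2) :=
    mul_nonneg (by nlinarith [norm_nonneg z]) (by nlinarith [norm_nonneg w])
  simp only [norm_mul]
  nlinarith [norm_nonneg (z + w), sq_nonneg (‖z‖ - ‖w‖)]

lemma analyticAt_clm_apply {D E F : Type*} [NormedAddCommGroup D] [NormedSpace ℂ D]
    [NormedAddCommGroup E] [NormedSpace ℂ E] [NormedAddCommGroup F] [NormedSpace ℂ F]
    {A : D → E →L[ℂ] F} {u : D → E} {s : D} (hA : AnalyticAt ℂ A s) (hu : AnalyticAt ℂ u s) :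
    AnalyticAt ℂ (fun s ↦ A s (u s)) s :=
  AnalyticAt.comp₂ (h := fun p : (E →L[ℂ] F) × E ↦ p.1 p.2) (f := A) (g := u)
    ((ContinuousLinearMap.id ℂ (E →L[ℂ] F)).analyticAt_bilinear (A s, u s)) hA hu

/-! ### The strict contraction s_T. -/

section Operator

variable {M : Type*} [NormedAddCommGroup M] [InnerProductSpace ℂ M]

/-- With a = ‖y‖, b = ‖Ty‖, p = |s.2|, q = |s.1| and k = |s.1 - conj s.1 s.2|, the difference of the
squared norms is at least (4 - q²)a² + (q² - 4p²)b² - 4kab. Subtracting c a² leaves (2 + 2p² -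
q²)(a² - b²) + 2k(a - b)² + 2(1 - p² - k)b², a sum of nonnegative terms. -/
lemma exists_norm_sq_add_le {s : ℂ × ℂ} (hs : s ∈ G) {T : M →L[ℂ] M} (hT : ‖T‖ ≤ 1) :
    ∃ c > 0, ∀ y : M, c * ‖y‖ ^ 2 + ‖(2 * s.2) • T y - s.1 • y‖ ^ 2 ≤
      ‖(2 : ℂ) • y - s.1 • T y‖ ^ 2 := by
  have hk := norm_sub_conj_mul_lt hs
  have h1 := norm_fst_sq_le hs
  refine ⟨2 * (1 - ‖s.2‖ ^ 2 - ‖s.1 - conj s.1 * s.2‖), by linarith, fun y ↦ ?_⟩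
  have hb : ‖T y‖ ≤ ‖y‖ := by simpa using T.le_of_opNorm_le hT y
  rw [norm_sub_sq (𝕜 := ℂ), norm_sub_sq (𝕜 := ℂ), norm_smul, norm_smul, norm_smul, norm_smul,
    inner_smul_left, inner_smul_right, inner_smul_left, inner_smul_right, norm_mul]
  have hre : RCLike.re (conj (2 * s.2) * (s.1 * inner ℂ (T y) y)) =
      2 * RCLike.re (s.2 * conj s.1 * inner ℂ y (T y)) := by
    rw [← RCLike.conj_re (conj (2 * s.2) * (s.1 * inner ℂ (T y) y))]
    simp only [map_mul, RingHomCompTriple.comp_apply, RingHom.id_apply, inner_conj_symm, map_ofNat]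
    have : (2 : ℂ) * s.2 * (conj s.1 * inner ℂ y (T y)) =
      ((2 : ℝ) : ℂ) * (s.2 * conj s.1 * inner ℂ y (T y)) := by push_cast; ring
    simp only [RCLike.re_eq_complex_re, this, Complex.re_ofReal_mul]
  have hre' : RCLike.re (conj (2 : ℂ) * (s.1 * inner ℂ y (T y))) =
      2 * RCLike.re (s.1 * inner ℂ y (T y)) := by
    have : conj (2 : ℂ) * (s.1 * inner ℂ y (T y)) = ((2 : ℝ) : ℂ) * (s.1 * inner ℂ y (T y)) := by
      rw [map_ofNat]
      norm_cast
    simp only [RCLike.re_eq_complex_re, this, Complex.re_ofReal_mul]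
  rw [hre, hre']
  have hcross : RCLike.re (s.1 * inner ℂ y (T y)) - RCLike.re (s.2 * conj s.1 * inner ℂ y (T y))
      ≤ ‖s.1 - conj s.1 * s.2‖ * (‖y‖ * ‖T y‖) := by
    rw [← map_sub]
    calc _ ≤ ‖s.1 * inner ℂ y (T y) - s.2 * conj s.1 * inner ℂ y (T y)‖ := RCLike.re_le_norm _
      _ = ‖s.1 - conj s.1 * s.2‖ * ‖(inner ℂ y (T y) : ℂ)‖ := by rw [← norm_mul]; congr 1; ring
      _ ≤ _ := by gcongr; exact norm_inner_le_norm _ _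
  simp only [Complex.norm_ofNat]
  have ha := norm_nonneg y
  have hb0 := norm_nonneg (T y)
  set a := ‖y‖
  set b := ‖T y‖
  set p := ‖s.2‖
  set q := ‖s.1‖
  set k := ‖s.1 - conj s.1 * s.2‖
  have e1 : 0 ≤ (2 + 2 * p ^ 2 - q ^ 2) * (a - b) * (a + b) :=
    mul_nonneg (mul_nonneg (by linarith) (by linarith)) (by linarith)
  have e2 : 0 ≤ k * (a - b) ^ 2 := mul_nonneg (norm_nonneg _) (sq_nonneg _)
  have e3 : 0 ≤ (1 - p ^ 2 - k) * b ^ 2 := mul_nonneg (by linarith) (sq_nonneg _)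
  nlinarith

variable [CompleteSpace M]

lemma isUnit_two_sub {c : ℂ} (hc : ‖c‖ < 2) {T : M →L[ℂ] M} (hT : ‖T‖ ≤ 1) :
    IsUnit ((2 : ℂ) • (1 : M →L[ℂ] M) - c • T) := by
  have h : (2 : ℂ) • (1 : M →L[ℂ] M) - c • T =
      Units.mk0 (2 : ℂ) two_ne_zero • (1 - (c / 2) • T) := by
    rw [Units.smul_def, Units.val_mk0, smul_sub, smul_smul]
    congr 2
    ring
  rw [h]
  refine IsUnit.smul _ (isUnit_one_sub_of_norm_lt_one ?_)
  calc ‖(c / 2) • T‖ ≤ ‖c / 2‖ * 1 := by rw [norm_smul]; gcongr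
    _ < 1 := by rw [mul_one, norm_div, Complex.norm_ofNat]; linarith

lemma opAt_mul {s : ℂ × ℂ} (hs : s ∈ G) {T : M →L[ℂ] M} (hT : ‖T‖ ≤ 1) :
    opAt s T * ((2 : ℂ) • (1 : M →L[ℂ] M) - s.1 • T) =
      (2 * s.2) • T - s.1 • (1 : M →L[ℂ] M) := by
  rw [opAt, mul_assoc, Ring.inverse_mul_cancel _ (isUnit_two_sub (norm_fst_lt_two hs) hT), mul_one]

lemma opAt_apply {s : ℂ × ℂ} (hs : s ∈ G) {T : M →L[ℂ] M} (hT : ‖T‖ ≤ 1) (y : M) :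
    opAt s T ((2 : ℂ) • y - s.1 • T y) = (2 * s.2) • T y - s.1 • y := by
  simpa using DFunLike.congr_fun (opAt_mul hs hT) y

lemma norm_opAt_lt_one {s : ℂ × ℂ} (hs : s ∈ G) {T : M →L[ℂ] M} (hT : ‖T‖ ≤ 1) :
    ‖opAt s T‖ < 1 := by
  obtain ⟨c, hc, h⟩ := exists_norm_sq_add_le hs hT
  -- The 16 is the square of the 4 in ‖(2 - s¹T)y‖ ≤ 4‖y‖; the minimum with 1 keeps the radicand
  -- below nonnegative.
  have hle : ∀ x : M, ‖opAt s T x‖ ^ 2 ≤ (1 - min (c / 16) 1) * ‖x‖ ^ 2 := by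
    intro x
    set y : M := Ring.inverse ((2 : ℂ) • (1 : M →L[ℂ] M) - s.1 • T) x with hy
    have hx : x = (2 : ℂ) • y - s.1 • T y := by
      have := DFunLike.congr_fun (Ring.mul_inverse_cancel _
        (isUnit_two_sub (norm_fst_lt_two hs) hT)) x
      simpa [hy] using this.symm
    have hb : ‖T y‖ ≤ ‖y‖ := by simpa using T.le_of_opNorm_le hT y
    have hxy : ‖x‖ ≤ 4 * ‖y‖ := by
      rw [hx]
      refine (norm_sub_le _ _).trans ?_
      rw [norm_smul, norm_smul, Complex.norm_ofNat]
      nlinarith [norm_fst_lt_two hs, norm_nonneg y, norm_nonneg s.1, norm_nonneg (T y)]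
    have h1 := h y
    rw [hx, opAt_apply hs hT, ← hx]
    rw [← hx] at h1
    have h2 : ‖x‖ ^ 2 ≤ 16 * ‖y‖ ^ 2 := by nlinarith [norm_nonneg x]
    have h3 : min (c / 16) 1 * ‖x‖ ^ 2 ≤ c / 16 * ‖x‖ ^ 2 := by gcongr; exact min_le_left _ _
    have h4 : c / 16 * ‖x‖ ^ 2 ≤ c / 16 * (16 * ‖y‖ ^ 2) := by gcongr
    linarith
  have hm : 0 < min (c / 16) 1 := lt_min (by positivity) one_pos
  have hm' : 0 ≤ 1 - min (c / 16) 1 := by linarith [min_le_right (c / 16) 1]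
  calc ‖opAt s T‖ ≤ √(1 - min (c / 16) 1) := by
        refine ContinuousLinearMap.opNorm_le_bound _ (Real.sqrt_nonneg _) fun x ↦ ?_
        refine le_of_sq_le_sq ?_ (by positivity)
        rw [mul_pow, Real.sq_sqrt hm']
        exact hle x
    _ < 1 := by
        rw [Real.sqrt_lt' one_pos]
        linarith

lemma analyticAt_opAt {s : ℂ × ℂ} (hs : s ∈ G) {T : M →L[ℂ] M} (hT : ‖T‖ ≤ 1) :
    AnalyticAt ℂ (fun s ↦ opAt s T) s := by
  unfold opAt
  have h1 : AnalyticAt ℂ (fun s : ℂ × ℂ ↦ (2 * s.2) • T - s.1 • (1 : M →L[ℂ] M)) s := by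
    have := analyticAt_fst (𝕜 := ℂ) (p := s)
    have := analyticAt_snd (𝕜 := ℂ) (p := s)
    fun_prop
  have h2 : AnalyticAt ℂ (fun s : ℂ × ℂ ↦ (2 : ℂ) • (1 : M →L[ℂ] M) - s.1 • T) s := by
    have := analyticAt_fst (𝕜 := ℂ) (p := s)
    fun_prop
  obtain ⟨v, hv⟩ := isUnit_two_sub (norm_fst_lt_two hs) hT
  refine h1.mul (AnalyticAt.fun_comp ?_ h2)
  rw [← hv]
  exact analyticAt_inverse v

omit [CompleteSpace M] in
lemma ringInverse_apply_apply {A : M →L[ℂ] M} (hA : IsUnit A) (x : M) :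
    Ring.inverse A (A x) = x :=
  DFunLike.congr_fun (Ring.inverse_mul_cancel A hA) x

lemma norm_le_one_of_mem_unitary {T : M →L[ℂ] M} (hT : T ∈ unitary (M →L[ℂ] M)) : ‖T‖ ≤ 1 :=
  T.opNorm_le_bound zero_le_one fun x ↦ by
    rw [one_mul, ContinuousLinearMap.norm_map_of_mem_unitary hT]

lemma inner_one_sub_adjoint_mul (A B : M →L[ℂ] M) (x y : M) :
    inner ℂ y ((1 - ContinuousLinearMap.adjoint B * A) x) = inner ℂ y x - inner ℂ (B y) (A x) := by
  simp [ContinuousLinearMap.adjoint_inner_right]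

end Operator

/-! ### Functions with a model are Schur. -/

lemma HasGModel.mem_schurClass {φ : ℂ × ℂ → ℂ} (h : HasGModel.{u} φ) : φ ∈ SchurClass := by
  obtain ⟨M, _, _, _, T, u, hT, hu, hm⟩ := h
  simp only [inner_one_sub_adjoint_mul] at hm
  constructor
  · by_cases h0 : ∃ t ∈ G, φ t ≠ 0
    · obtain ⟨t, ht, h0⟩ := h0
      intro s hs
      have hc : conj (φ t) ≠ 0 := by simpa using h0
      have h1 : φ =ᶠ[nhds s] fun s ↦ (1 - (innerSL ℂ (u t) (u s) -
          innerSL ℂ (opAt t T (u t)) (opAt s T (u s)))) / conj (φ t) := by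
        filter_upwards [isOpen_G.mem_nhds hs] with r hr
        rw [eq_div_iff hc]
        have := hm r hr t ht
        simp only [innerSL_apply_apply]
        linear_combination -this
      refine AnalyticAt.congr ?_ h1.symm
      have h2 := hu s hs
      have h3 := analyticAt_clm_apply (analyticAt_opAt hs hT) h2
      have h4 := ((innerSL ℂ (u t)).analyticAt _).fun_comp h2
      have h5 := ((innerSL ℂ (opAt t T (u t))).analyticAt _).fun_comp h3
      exact (analyticAt_const.sub (h4.sub h5)).div analyticAt_const hc
    · push Not at h0
      intro s hs
      have : φ =ᶠ[nhds s] fun _ ↦ 0 := by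
        filter_upwards [isOpen_G.mem_nhds hs] with r hr using h0 r hr
      exact analyticAt_const.congr this.symm
  · intro s hs
    have h1 := hm s hs s hs
    rw [Complex.conj_mul', inner_self_eq_norm_sq_to_K, inner_self_eq_norm_sq_to_K] at h1
    have h2 : 1 - ‖φ s‖ ^ 2 = ‖u s‖ ^ 2 - ‖opAt s T (u s)‖ ^ 2 := by exact Complex.ofReal_injective (by push_cast; exact h1)
    have h3 : ‖opAt s T (u s)‖ ≤ ‖u s‖ := by
      simpa using (opAt s T).le_of_opNorm_le (norm_opAt_lt_one hs hT).le (u s)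
    nlinarith [norm_nonneg (φ s), norm_nonneg (opAt s T (u s))]

end SymBidisc

namespace SymBidisc

open scoped ComplexConjugate InnerProductSpace

/-! ### Lurking isometries and unitaries. -/

section Lurking

open ContinuousLinearMap

variable {ι E F : Type*} [NormedAddCommGroup E] [InnerProductSpace ℂ E] [CompleteSpace E]
  [NormedAddCommGroup F] [InnerProductSpace ℂ F] [CompleteSpace F]

omit [CompleteSpace E] [CompleteSpace F] in
lemma norm_linearCombination_eq {a : ι → E} {b : ι → F}
    (h : ∀ i j, inner ℂ (a i) (a j) = inner ℂ (b i) (b j)) (c : ι →₀ ℂ) :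
    ‖Finsupp.linearCombination ℂ a c‖ = ‖Finsupp.linearCombination ℂ b c‖ := by
  have : (inner ℂ (Finsupp.linearCombination ℂ a c) (Finsupp.linearCombination ℂ a c) : ℂ) =
      inner ℂ (Finsupp.linearCombination ℂ b c) (Finsupp.linearCombination ℂ b c) := by
    simp only [Finsupp.linearCombination_apply, Finsupp.sum, sum_inner, inner_sum,
      inner_smul_left, inner_smul_right, h]
  rw [@norm_eq_sqrt_re_inner ℂ, @norm_eq_sqrt_re_inner ℂ, this]

/-- Two families with the same Gram matrix are related by a partial isometry. -/
lemma exists_partialIsometry {a : ι → E} {b : ι → F}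
    (h : ∀ i j, inner ℂ (a i) (a j) = inner ℂ (b i) (b j)) :
    ∃ W : E →L[ℂ] F, ‖W‖ ≤ 1 ∧ (∀ x, W (adjoint W (W x)) = W x) ∧
      ∀ i, W (a i) = b i ∧ adjoint W (b i) = a i := by
  set K : Submodule ℂ E := (Submodule.span ℂ (Set.range a)).topologicalClosure with hK
  have haK : ∀ i, a i ∈ K := fun i ↦
    Submodule.le_topologicalClosure _ (Submodule.subset_span ⟨i, rfl⟩)
  set e : (ι →₀ ℂ) →ₗ[ℂ] K := Finsupp.linearCombination ℂ fun i ↦ (⟨a i, haK i⟩ : K) with he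
  set f : (ι →₀ ℂ) →ₗ[ℂ] F := Finsupp.linearCombination ℂ b with hf
  have hcoe : ∀ c, ((e c : K) : E) = Finsupp.linearCombination ℂ a c := by
    intro c
    simp [he, Finsupp.linearCombination_apply, Finsupp.sum]
  have hnorm : ∀ c, ‖f c‖ = ‖e c‖ := by
    intro c
    have : ‖e c‖ = ‖((e c : K) : E)‖ := rfl
    rw [this, hcoe, norm_linearCombination_eq h]
  have hdense : DenseRange e := by
    intro x
    rw [Metric.mem_closure_iff]
    intro ε hε
    obtain ⟨y, hy, hxy⟩ := Metric.mem_closure_iff.1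
      (show (x : E) ∈ closure (Submodule.span ℂ (Set.range a) : Set E) from x.2) ε hε
    rw [SetLike.mem_coe, ← Finsupp.range_linearCombination] at hy
    obtain ⟨c, rfl⟩ := hy
    refine ⟨e c, ⟨c, rfl⟩, ?_⟩
    rw [Subtype.dist_eq, hcoe]
    exact hxy
  have hle : ∃ C, ∀ c, ‖f c‖ ≤ C * ‖e c‖ := ⟨1, fun c ↦ by rw [hnorm, one_mul]⟩
  set W₀ : K →L[ℂ] F := f.extendOfNorm e with hW₀
  have hW₀e : ∀ c, W₀ (e c) = f c := LinearMap.extendOfNorm_eq hdense hle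
  have hiso : ∀ x, ‖W₀ x‖ = ‖x‖ := by
    intro x
    refine hdense.induction_on (p := fun x ↦ ‖W₀ x‖ = ‖x‖) x
      (isClosed_eq (by fun_prop) (by fun_prop)) fun c ↦ ?_
    rw [hW₀e, hnorm]
  have hadj : ∀ x, adjoint W₀ (W₀ x) = x := fun x ↦
    DFunLike.congr_fun ((norm_map_iff_adjoint_comp_self W₀).1 hiso) x
  have hKK : adjoint (K.orthogonalProjectionOnto) = K.subtypeL := by
    rw [← Submodule.adjoint_subtypeL, adjoint_adjoint]
  have hWW : ∀ x, adjoint (W₀ ∘L K.orthogonalProjectionOnto) (W₀ (K.orthogonalProjectionOnto x))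
      = K.orthogonalProjectionOnto x := by
    intro x
    rw [adjoint_comp, comp_apply, hadj, hKK]
    rfl
  have hPa : ∀ i, K.orthogonalProjectionOnto (a i) = ⟨a i, haK i⟩ := fun i ↦
    Submodule.orthogonalProjectionOnto_mem_subspace_eq_self (⟨a i, haK i⟩ : K)
  have hWa : ∀ i, W₀ (K.orthogonalProjectionOnto (a i)) = b i := by
    intro i
    have := hW₀e (Finsupp.single i 1)
    rw [he, hf, Finsupp.linearCombination_single, Finsupp.linearCombination_single, one_smul,
      one_smul] at this
    rw [hPa, this]
  refine ⟨W₀ ∘L K.orthogonalProjectionOnto, ?_, fun x ↦ ?_, fun i ↦ ⟨hWa i, ?_⟩⟩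
  · refine opNorm_le_bound _ zero_le_one fun x ↦ ?_
    rw [comp_apply, hiso, one_mul]
    exact K.norm_orthogonalProjectionOnto_apply_le x
  · change W₀ (K.orthogonalProjectionOnto (adjoint (W₀ ∘L K.orthogonalProjectionOnto)
      (W₀ (K.orthogonalProjectionOnto x)))) = W₀ (K.orthogonalProjectionOnto x)
    rw [hWW]
    congr 1
    exact Submodule.orthogonalProjectionOnto_mem_subspace_eq_self _
  · rw [← hWa i, hWW, hPa]

/-- The Halmos unitary `[[W, 1 - W W*], [1 - W* W, -W*]]` of a partial isometry `W`. -/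
lemma exists_unitary_extension {a b : ι → E}
    (h : ∀ i j, inner ℂ (a i) (a j) = inner ℂ (b i) (b j)) :
    ∃ T ∈ unitary (WithLp 2 (E × E) →L[ℂ] WithLp 2 (E × E)),
      ∀ i, T (WithLp.toLp 2 (a i, 0)) = WithLp.toLp 2 (b i, 0) := by
  obtain ⟨W, -, hW, hab⟩ := exists_partialIsometry h
  have hW' : ∀ x, adjoint W (W (adjoint W x)) = adjoint W x := by
    intro x
    refine ext_inner_right ℂ fun y ↦ ?_
    rw [adjoint_inner_left, ← adjoint_inner_right W (adjoint W x), adjoint_inner_left, hW,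
      adjoint_inner_left]
  let H (A B C D : E →L[ℂ] E) : WithLp 2 (E × E) →L[ℂ] WithLp 2 (E × E) :=
    (WithLp.prodContinuousLinearEquiv 2 ℂ E E).symm.toContinuousLinearMap ∘L
      ((A ∘L WithLp.fstL 2 ℂ E E + B ∘L WithLp.sndL 2 ℂ E E).prod
        (C ∘L WithLp.fstL 2 ℂ E E + D ∘L WithLp.sndL 2 ℂ E E))
  have H_apply : ∀ A B C D x, H A B C D x =
      WithLp.toLp 2 (A x.fst + B x.snd, C x.fst + D x.snd) := fun _ _ _ _ _ ↦ rfl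
  set T := H W (1 - W ∘L adjoint W) (1 - adjoint W ∘L W) (-adjoint W) with hT
  set T' := H (adjoint W) (1 - adjoint W ∘L W) (1 - W ∘L adjoint W) (-W) with hT'
  have hadj : T' = star T := by
    rw [star_eq_adjoint, eq_adjoint_iff]
    rintro ⟨x₁, x₂⟩ ⟨y₁, y₂⟩
    simp only [hT, hT', H_apply, WithLp.prod_inner_apply, sub_apply, one_apply_eq_self,
      comp_apply, neg_apply, inner_add_left, inner_add_right, inner_sub_left, inner_sub_right, inner_neg_left,
      inner_neg_right, adjoint_inner_left, WithLp.toLp_fst, WithLp.toLp_snd]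
    simp only [adjoint_inner_right]
    rw [← adjoint_inner_right W (adjoint W x₁), adjoint_inner_left]
    ring
  refine ⟨T, Unitary.mem_iff.2 ⟨?_, ?_⟩, fun i ↦ ?_⟩
  · rw [← hadj]
    ext ⟨x₁, x₂⟩
    simp [hT, hT', H_apply, hW, hW']
  · rw [← hadj]
    ext ⟨x₁, x₂⟩
    simp [hT, hT', H_apply, hW, hW']
  · simp [hT, H_apply, hab]

end Lurking

/-! ### From a symmetric decomposition to a unitary model. -/

section Realization

variable {M : Type u} [NormedAddCommGroup M] [InnerProductSpace ℂ M] [CompleteSpace M]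

/-- In a model with `T` unitary, `u` can be chosen analytic: it is `(1 - D s_T)⁻¹ C` for the
contraction `[[A, B], [C, D]]` that maps `(1, s_T u(s))` to `(φ(s), u(s))`. -/
lemma hasUnitaryGModel_of_unitary {φ : ℂ × ℂ → ℂ} {T : M →L[ℂ] M} (hT : T ∈ unitary (M →L[ℂ] M))
    {u : ℂ × ℂ → M} (h : ∀ s ∈ G, ∀ t ∈ G, 1 - conj (φ t) * φ s =
      inner ℂ (u t) (u s) - inner ℂ (opAt t T (u t)) (opAt s T (u s))) :
    HasUnitaryGModel.{u} φ := by
  have hT1 : ‖T‖ ≤ 1 := norm_le_one_of_mem_unitary hT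
  obtain ⟨W, hW, -, hab⟩ := exists_partialIsometry (ι := G)
    (a := fun s ↦ (WithLp.toLp 2 ((1 : ℂ), opAt s T (u s)) : WithLp 2 (ℂ × M)))
    (b := fun s ↦ (WithLp.toLp 2 (φ s, u s) : WithLp 2 (ℂ × M))) (by
      intro t s
      simp only [WithLp.prod_inner_apply, RCLike.inner_apply]
      have := h s s.2 t t.2
      simp only [map_one]
      linear_combination this)
  set i₂ : M →L[ℂ] WithLp 2 (ℂ × M) :=
    (WithLp.prodContinuousLinearEquiv 2 ℂ ℂ M).symm.toContinuousLinearMap ∘L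
      ContinuousLinearMap.inr ℂ ℂ M with hi₂
  have hi₂x : ∀ x, i₂ x = WithLp.toLp 2 (0, x) := fun _ ↦ rfl
  set C : M := (W (WithLp.toLp 2 (1, 0))).snd
  set D : M →L[ℂ] M := WithLp.sndL 2 ℂ ℂ M ∘L W ∘L i₂ with hD
  have hD1 : ‖D‖ ≤ 1 := by
    refine ContinuousLinearMap.opNorm_le_bound _ zero_le_one fun x ↦ ?_
    calc ‖D x‖ ≤ ‖W (i₂ x)‖ := WithLp.norm_snd_le _ (W (i₂ x))
      _ ≤ 1 * ‖i₂ x‖ := W.le_of_opNorm_le hW _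
      _ = 1 * ‖x‖ := by rw [hi₂x, WithLp.norm_toLp_snd]
  have hunit : ∀ s ∈ G, IsUnit (1 - D * opAt s T) := by
    intro s hs
    refine isUnit_one_sub_of_norm_lt_one ((norm_mul_le _ _).trans_lt ?_)
    nlinarith [norm_opAt_lt_one hs hT1, norm_nonneg (opAt s T)]
  -- The given u has no regularity, but the second component of `hab` reads u = C + D s_T u, which
  -- determines u on G.
  have hu : ∀ s ∈ G, Ring.inverse (1 - D * opAt s T) C = u s := by
    intro s hs
    have h1 : (1 - D * opAt s T) (u s) = C := by
      have h2 : u s = C + D (opAt s T (u s)) := by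
        have h3 := congrArg WithLp.snd (hab ⟨s, hs⟩).1
        have h4 : WithLp.toLp 2 ((1 : ℂ), opAt s T (u s)) =
            WithLp.toLp 2 (1, 0) + i₂ (opAt s T (u s)) := by
          rw [hi₂x, ← WithLp.toLp_add]
          simp
        simp only [h4, map_add] at h3
        exact h3.symm
      rw [sub_apply, one_apply_eq_self, sub_eq_iff_eq_add]
      exact h2
    rw [← h1, ringInverse_apply_apply (hunit s hs)]
  refine ⟨M, _, _, _, T, fun s ↦ Ring.inverse (1 - D * opAt s T) C, ⟨hT1, fun s hs ↦ ?_,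
    fun s hs t ht ↦ ?_⟩, hT⟩
  · refine analyticAt_clm_apply ?_ analyticAt_const
    have h1 : AnalyticAt ℂ (fun s ↦ 1 - D * opAt s T) s :=
      analyticAt_const.sub (analyticAt_const.mul (analyticAt_opAt hs hT1))
    obtain ⟨v, hv⟩ := hunit s hs
    refine AnalyticAt.fun_comp ?_ h1
    rw [← hv]
    exact analyticAt_inverse v
  · rw [inner_one_sub_adjoint_mul]
    simp only [hu s hs, hu t ht]
    exact h s hs t ht

/-- A symmetric Agler decomposition on the bidisc yields a model with `T` unitary. -/
lemma hasUnitaryGModel_of_decomposition {φ : ℂ × ℂ → ℂ} {v : ℂ → ℂ → M}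
    (h : ∀ z w z' w' : ℂ, ‖z‖ < 1 → ‖w‖ < 1 → ‖z'‖ < 1 → ‖w'‖ < 1 →
      1 - conj (φ (z' + w', z' * w')) * φ (z + w, z * w) =
        (1 - conj z' * z) * inner ℂ (v z' w') (v z w) +
          (1 - conj w' * w) * inner ℂ (v w' z') (v w z)) :
    HasUnitaryGModel.{u} φ := by
  obtain ⟨T, hT, hTv⟩ := exists_unitary_extension
    (ι := {p : ℂ × ℂ // ‖p.1‖ < 1 ∧ ‖p.2‖ < 1})
    (a := fun p ↦ p.1.1 • v p.1.1 p.1.2 - p.1.2 • v p.1.2 p.1.1)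
    (b := fun p ↦ v p.1.1 p.1.2 - v p.1.2 p.1.1) (by
      rintro ⟨⟨z', w'⟩, hz', hw'⟩ ⟨⟨z, w⟩, hz, hw⟩
      have h1 := h z w z' w' hz hw hz' hw'
      -- Swapping z' and w' leaves the value of φ alone, so `h1` and `h2` have the same left side;
      -- their difference is the equality of Gram matrices.
      have h2 := h z w w' z' hz hw hw' hz'
      rw [add_comm w' z', mul_comm w' z'] at h2
      simp only [inner_sub_left, inner_sub_right, inner_smul_left, inner_smul_right]
      linear_combination h1 - h2)
  have hT1 : ‖T‖ ≤ 1 := norm_le_one_of_mem_unitary hT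
  have hTT : ∀ x y, (inner ℂ (T x) (T y) : ℂ) = inner ℂ x y := by
    intro x y
    exact ContinuousLinearMap.inner_map_map_of_mem_unitary hT x y
  have hunit : ∀ w : ℂ, ‖w‖ < 1 → IsUnit (1 - w • T) := by
    intro w hw
    refine isUnit_one_sub_of_norm_lt_one ?_
    rw [norm_smul]
    nlinarith [norm_nonneg w]
  set V : ℂ → ℂ → WithLp 2 (M × M) := fun z w ↦ WithLp.toLp 2 (v z w, 0) with hV
  have hVV : ∀ z w z' w', (inner ℂ (V z w) (V z' w') : ℂ) = inner ℂ (v z w) (v z' w') := by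
    intro z w z' w'
    simp [hV, WithLp.prod_inner_apply]
  have hVT : ∀ z w : ℂ, ‖z‖ < 1 → ‖w‖ < 1 → z • T (V z w) - w • T (V w z) = V z w - V w z := by
    intro z w hz hw
    have h1 := hTv ⟨(z, w), hz, hw⟩
    have h2 : WithLp.toLp 2 (z • v z w - w • v w z, (0 : M)) = z • V z w - w • V w z := by
      simp [hV, ← WithLp.toLp_smul, ← WithLp.toLp_sub]
    have h3 : WithLp.toLp 2 (v z w - v w z, (0 : M)) = V z w - V w z := by
      simp [hV, ← WithLp.toLp_sub]
    simp only [h2, h3, map_sub, map_smul] at h1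
    exact h1
  have hx : ∀ z w : ℂ, ‖z‖ < 1 → ‖w‖ < 1 → ∃ x, V z w = x - w • T x ∧ V w z = x - z • T x := by
    intro z w hz hw
    set x := Ring.inverse (1 - w • T) (V z w) with hx
    have h1 : V z w = x - w • T x := by
      have := DFunLike.congr_fun (Ring.mul_inverse_cancel _ (hunit w hw)) (V z w)
      simpa [hx] using this.symm
    refine ⟨x, h1, ?_⟩
    have h2 : (1 - w • T) (V w z) = (1 - w • T) (x - z • T x) := by
      -- This is (1 - wT)V(w, z) = (1 - zT)V(z, w). As 1 - zT and 1 - wT commute, the factor 1 - wT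
      -- then cancels.
      have h3 : V w z - w • T (V w z) = V z w - z • T (V z w) := by
        have h4 := hVT z w hz hw
        rw [sub_eq_sub_iff_add_eq_add] at h4 ⊢
        rw [add_comm, h4]
      have h4 : (1 - w • T) (V w z) = V w z - w • T (V w z) := rfl
      rw [h4, h3, h1]
      simp only [sub_apply, one_apply_eq_self, smul_apply, map_sub, map_smul, smul_sub,
        smul_comm z w]
    have h5 := congrArg (fun y ↦ Ring.inverse (1 - w • T) y) h2
    rwa [ringInverse_apply_apply (hunit w hw), ringInverse_apply_apply (hunit w hw)] at h5
  choose! x hx1 hx2 using hx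
  -- The order of the roots is chosen arbitrarily at each s: analyticity of u is recovered by
  -- `hasUnitaryGModel_of_unitary`.
  have hr : ∀ s : ℂ × ℂ, ∃ z w : ℂ, s ∈ G → ‖z‖ < 1 ∧ ‖w‖ < 1 ∧ s = (z + w, z * w) := by
    intro s
    by_cases hs : s ∈ G
    · obtain ⟨z, w, hzw⟩ := hs
      exact ⟨z, w, fun _ ↦ hzw⟩
    · exact ⟨0, 0, fun h ↦ absurd h hs⟩
  choose z w hzw using hr
  have hc : conj ((√2 : ℝ) / 2 : ℂ) * ((√2 : ℝ) / 2 : ℂ) = 1 / 2 := by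
    rw [map_div₀, Complex.conj_ofReal, map_ofNat, div_mul_div_comm, ← Complex.ofReal_mul,
      Real.mul_self_sqrt (by norm_num)]
    norm_num
  refine hasUnitaryGModel_of_unitary hT (u := fun s ↦ ((√2 : ℝ) / 2 : ℂ) •
    ((2 : ℂ) • x (z s) (w s) - s.1 • T (x (z s) (w s)))) fun s hs t ht ↦ ?_
  obtain ⟨hz, hw, es⟩ := hzw s hs
  obtain ⟨hz', hw', et⟩ := hzw t ht
  have key := h (z s) (w s) (z t) (w t) hz hw hz' hw'
  rw [← es, ← et, ← hVV, ← hVV, hx1 _ _ hz hw, hx2 _ _ hz hw, hx1 _ _ hz' hw', hx2 _ _ hz' hw']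
    at key
  rw [map_smul, map_smul, opAt_apply hs hT1, opAt_apply ht hT1, key]
  have e1 : s.1 = z s + w s := congrArg Prod.fst es
  have e2 : s.2 = z s * w s := congrArg Prod.snd es
  have e3 : t.1 = z t + w t := congrArg Prod.fst et
  have e4 : t.2 = z t * w t := congrArg Prod.snd et
  rw [e1, e2, e3, e4]
  simp only [inner_sub_left, inner_sub_right, inner_smul_left, inner_smul_right, hTT, map_add,
    map_mul, map_ofNat]
  generalize z s = z, w s = w, z t = z', w t = w'
  linear_combination (-2 * ((2 - 2 * (z * w) * (conj z' * conj w')) * inner ℂ (x z' w') (x z w) +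
    (z * w * (conj z' + conj w') - (z + w)) * inner ℂ (x z' w') (T (x z w)) +
    (conj z' * conj w' * (z + w) - (conj z' + conj w')) * inner ℂ (T (x z' w')) (x z w))) * hc

end Realization

end SymBidisc

namespace SymBidisc

open scoped ComplexConjugate InnerProductSpace

/-! ### The abstract geometry behind Agler's theorem. -/

section Decomposition

variable {E K : Type*} [NormedAddCommGroup E] [InnerProductSpace ℂ E]
  [NormedAddCommGroup K] [InnerProductSpace ℂ K]

/-- This absorbs one factor of the inverse Szegő kernel into an inner product. -/
lemma inner_sub_smul_isometry {V : K →ₗᵢ[ℂ] K} {x y : K} {a b : ℂ}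
    (hxy : inner ℂ x (V y) = conj a * inner ℂ x y) (hyx : inner ℂ y (V x) = conj b * inner ℂ y x) :
    inner ℂ (x - a • V x) (y - b • V y) = (1 - conj a * b) * inner ℂ x y := by
  have h : inner ℂ (V x) y = b * inner ℂ x y := by
    rw [← inner_conj_symm, hyx, map_mul, Complex.conj_conj, inner_conj_symm]
  simp only [inner_sub_left, inner_sub_right, inner_smul_left, inner_smul_right,
    LinearIsometry.inner_map_map, hxy, h]
  ring

/-- Let `N` be the orthogonal complement in `X` of the subspace of `X` orthogonal to `J L`.
It is the closure of `P_X J L`, and `V` maps it into itself. -/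
lemma isometry_mem_orthogonal_of_mem [CompleteSpace K] {H L : Submodule ℂ E} {X : Submodule ℂ K}
    [X.HasOrthogonalProjection] {U : E →L[ℂ] E} {V : K →ₗᵢ[ℂ] K} {J : E →ₗᵢ[ℂ] K}
    (hUL : ∀ g ∈ L, U g ∈ L)
    (hU : ∀ h ∈ H, ∃ h' ∈ H, ∃ g₀ ∈ H, h = U h' + g₀ ∧ ∀ g ∈ L, (inner ℂ g₀ (U g) : ℂ) = 0)
    (hJ : ∀ x, J (U x) = V (J x)) (hJH : ∀ h ∈ H, J h ∈ X)
    (hq : ∀ g ∈ L, ∀ q ∈ Xᗮ, J g - q ∈ X → V q ∈ Xᗮ) {x : K} (hxX : x ∈ X)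
    (hx : x ∈ (X ⊓ (L.map J.toLinearMap)ᗮ)ᗮ) (hxH : ∀ h ∈ H, (inner ℂ (J h) x : ℂ) = 0) :
    V x ∈ (X ⊓ (L.map J.toLinearMap)ᗮ)ᗮ ∧ ∀ h ∈ H, (inner ℂ (J h) (V x) : ℂ) = 0 := by
  set S := X ⊓ (L.map J.toLinearMap)ᗮ with hS
  set W := H ⊓ (L.map U.toLinearMap)ᗮ with hW
  set R := (L.map J.toLinearMap).map X.starProjection.toLinearMap with hR
  have hxR : x ∈ R.topologicalClosure := by
    rw [← Submodule.orthogonal_orthogonal_eq_closure, Submodule.mem_orthogonal]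
    intro y hy
    have h1 : X.starProjection y ∈ S := by
      refine ⟨X.starProjection_apply_mem y, ?_⟩
      intro z hz
      rw [← Submodule.inner_starProjection_left_eq_right]
      exact (Submodule.mem_orthogonal _ _).1 hy _ (Submodule.mem_map_of_mem hz)
    have h2 := (Submodule.mem_orthogonal _ _).1 hx _ h1
    rwa [Submodule.inner_starProjection_left_eq_right,
      Submodule.starProjection_eq_self_iff.2 hxX] at h2
  -- For g ∈ L and y ∈ X, ⟨y, V P_X J g⟩ = ⟨y, J U g⟩, since V maps J g - P_X J g into Xᗮ. This
  -- vanishes for y ∈ S because U g ∈ L, and for y ∈ J W because W is orthogonal to U L.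
  have hRle : R ≤ ((S ⊔ W.map J.toLinearMap)ᗮ).comap V.toLinearMap := by
    rintro _ ⟨_, ⟨g, hg, rfl⟩, rfl⟩
    rw [Submodule.mem_comap, ← Submodule.inf_orthogonal]
    set p := X.starProjection (J g) with hp
    have hq' : V (J g - p) ∈ Xᗮ := by
      refine hq g hg _ (Submodule.sub_starProjection_mem_orthogonal _) ?_
      rw [sub_sub_cancel]
      exact X.starProjection_apply_mem _
    have e : V p = J (U g) - V (J g - p) := by rw [map_sub, hJ]; abel
    have key : ∀ y ∈ X, (inner ℂ y (V p) : ℂ) = inner ℂ y (J (U g)) := by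
      intro y hy
      rw [e, inner_sub_right, (Submodule.mem_orthogonal _ _).1 hq' y hy, sub_zero]
    refine ⟨fun y hy ↦ ?_, ?_⟩
    · refine (key y hy.1).trans ?_
      exact Submodule.inner_left_of_mem_orthogonal (Submodule.mem_map_of_mem (hUL g hg)) hy.2
    · rintro _ ⟨g₀, hg₀, rfl⟩
      refine (key _ (hJH _ hg₀.1)).trans ?_
      exact (J.inner_map_map _ _).trans
        (Submodule.inner_left_of_mem_orthogonal (Submodule.mem_map_of_mem hg) hg₀.2)
  have hVx : V x ∈ (S ⊔ W.map J.toLinearMap)ᗮ :=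
    Submodule.topologicalClosure_minimal _ hRle
      ((Submodule.isClosed_orthogonal _).preimage V.continuous) hxR
  rw [← Submodule.inf_orthogonal] at hVx
  refine ⟨hVx.1, fun h hh ↦ ?_⟩
  -- H = U H + W: on U H the isometry V cancels, and J W is already orthogonal to V x.
  obtain ⟨h', hh', g₀, hg₀, rfl, hg⟩ := hU h hh
  rw [map_add, inner_add_left, hJ, V.inner_map_map, hxH h' hh', zero_add]
  refine hVx.2 _ (Submodule.mem_map_of_mem ⟨hg₀, ?_⟩)
  rintro _ ⟨g, hg', rfl⟩
  rw [← inner_conj_symm, map_eq_zero]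
  exact hg g hg'

/-- The vectors r = f·Jk, p (the projection of e to S) and d = e - r - p are mutually orthogonal, so
(1 - conj f f)⟨k, k⟩ = ⟨d, d⟩ + ⟨p, p⟩. The kernel relation for V₁ passes from e to p because V₁ S ⊆
S, and that for V₂ passes to d by `isometry_mem_orthogonal_of_mem`. Multiplication by the inverse
kernel leaves each term one free factor. -/
lemma exists_decomposition [CompleteSpace K] {H L : Submodule ℂ E} {X : Submodule ℂ K}
    (hX : IsClosed (X : Set K)) {U₁ U₂ : E →L[ℂ] E} {V₁ V₂ : K →ₗᵢ[ℂ] K} {J : E →ₗᵢ[ℂ] K}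
    (hHL : H ≤ L) (hU₁ : ∀ g ∈ L, ∃ g' ∈ L, U₁ g' = g) (hUL : ∀ g ∈ L, U₂ g ∈ L)
    (hU : ∀ h ∈ H, ∃ h' ∈ H, ∃ g₀ ∈ H, h = U₂ h' + g₀ ∧ ∀ g ∈ L, (inner ℂ g₀ (U₂ g) : ℂ) = 0)
    (hJ₁ : ∀ x, J (U₁ x) = V₁ (J x)) (hJ₂ : ∀ x, J (U₂ x) = V₂ (J x)) (hJH : ∀ h ∈ H, J h ∈ X)
    (hV₁ : ∀ x ∈ X, V₁ x ∈ X)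
    (hq : ∀ g ∈ L, ∀ q ∈ Xᗮ, J g - q ∈ X → V₂ q ∈ Xᗮ)
    {ι : Type*} {e : ι → K} {k : ι → E} {a b f : ι → ℂ} (he : ∀ i, e i ∈ X)
    (ha : ∀ i, ∀ x ∈ X, inner ℂ (e i) (V₁ x) = conj (a i) * inner ℂ (e i) x)
    (hb : ∀ i, ∀ x ∈ X, inner ℂ (e i) (V₂ x) = conj (b i) * inner ℂ (e i) x)
    (hk : ∀ i, k i ∈ H) (hf : ∀ i, ∀ h ∈ H, inner ℂ (e i) (J h) = conj (f i) * inner ℂ (k i) h)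
    (hke : ∀ i j, (inner ℂ (e i) (e j) : ℂ) = inner ℂ (k i) (k j))
    (hkk : ∀ i j, (1 - conj (a i) * a j) * (1 - conj (b i) * b j) * inner ℂ (k i) (k j) = 1) :
    ∃ v₁ v₂ : ι → K, ∀ i j, 1 - conj (f i) * f j =
      (1 - conj (a i) * a j) * inner ℂ (v₁ i) (v₁ j) +
        (1 - conj (b i) * b j) * inner ℂ (v₂ i) (v₂ j) := by
  set S := X ⊓ (L.map J.toLinearMap)ᗮ with hS
  have : CompleteSpace X := hX.completeSpace_coe
  have : CompleteSpace S :=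
    (hX.inter (Submodule.isClosed_orthogonal (L.map J.toLinearMap))).completeSpace_coe
  have hSJ : ∀ y ∈ S, ∀ g ∈ L, (inner ℂ (J g) y : ℂ) = 0 := fun y hy g hg ↦
    (Submodule.mem_orthogonal _ _).1 hy.2 _ (Submodule.mem_map_of_mem hg)
  have hSJ' : ∀ y ∈ S, ∀ g ∈ L, (inner ℂ y (J g) : ℂ) = 0 := fun y hy g hg ↦ by
    rw [← inner_conj_symm, hSJ y hy g hg, map_zero]
  have hSV : ∀ y ∈ S, V₁ y ∈ S := by
    intro y hy
    refine ⟨hV₁ y hy.1, ?_⟩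
    rintro _ ⟨g, hg, rfl⟩
    -- Surjectivity of U₁ on L is what keeps V₁ y orthogonal to J L.
    obtain ⟨g', hg', rfl⟩ := hU₁ g hg
    change (inner ℂ (J (U₁ g')) (V₁ y) : ℂ) = 0
    rw [hJ₁, V₁.inner_map_map, hSJ y hy g' hg']
  set r : ι → K := fun i ↦ J (f i • k i) with hr
  set p : ι → K := fun i ↦ S.starProjection (e i) with hp
  set d : ι → K := fun i ↦ e i - r i - p i with hd
  have hpS : ∀ i, p i ∈ S := fun i ↦ S.starProjection_apply_mem _
  have hfk : ∀ i, f i • k i ∈ H := fun i ↦ H.smul_mem _ (hk i)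
  have hrX : ∀ i, r i ∈ X := fun i ↦ hJH _ (hfk i)
  have hpe : ∀ i, ∀ y ∈ S, (inner ℂ (p i) y : ℂ) = inner ℂ (e i) y := by
    intro i y hy
    rw [hp, Submodule.inner_starProjection_left_eq_right, Submodule.starProjection_eq_self_iff.2 hy]
  have hrS : ∀ i, ∀ y ∈ S, (inner ℂ (r i) y : ℂ) = 0 := fun i y hy ↦ hSJ y hy _ (hHL (hfk i))
  have hdX : ∀ i, d i ∈ X := fun i ↦ X.sub_mem (X.sub_mem (he i) (hrX i)) (hpS i).1
  have hdS : ∀ i, ∀ y ∈ S, (inner ℂ (d i) y : ℂ) = 0 := by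
    intro i y hy
    simp only [hd, inner_sub_left, hrS i y hy, hpe i y hy]
    ring
  have hdS' : ∀ i, d i ∈ Sᗮ := fun i ↦ (Submodule.mem_orthogonal' _ _).2 (hdS i)
  have hdH : ∀ i, ∀ h ∈ H, (inner ℂ (d i) (J h) : ℂ) = 0 := by
    intro i h hh
    simp only [hd, inner_sub_left, hf i h hh, hSJ' _ (hpS i) _ (hHL hh), hr, J.inner_map_map,
      inner_smul_left]
    ring
  have hdH' : ∀ i, ∀ h ∈ H, (inner ℂ (J h) (d i) : ℂ) = 0 := fun i h hh ↦ by
    rw [← inner_conj_symm, hdH i h hh, map_zero]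
  have hdV : ∀ i j, inner ℂ (d i) (V₂ (d j)) = conj (b i) * inner ℂ (d i) (d j) := by
    intro i j
    obtain ⟨h1, h2⟩ := isometry_mem_orthogonal_of_mem hUL hU hJ₂ hJH hq (hdX j) (hdS' j)
      (hdH' j)
    have h3 : (inner ℂ (d i) (V₂ (d j)) : ℂ) = inner ℂ (e i) (V₂ (d j)) := by
      simp only [hd, inner_sub_left]
      rw [h2 _ (hfk i), (Submodule.mem_orthogonal _ _).1 h1 _ (hpS i)]
      ring
    have h4 : (inner ℂ (d i) (d j) : ℂ) = inner ℂ (e i) (d j) := by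
      conv_lhs => rw [hd]
      simp only [inner_sub_left]
      rw [hdH' j _ (hfk i), (Submodule.mem_orthogonal _ _).1 (hdS' j) _ (hpS i)]
      ring
    rw [h3, h4, hb i _ (hdX j)]
  have hpV : ∀ i j, inner ℂ (p i) (V₁ (p j)) = conj (a i) * inner ℂ (p i) (p j) := by
    intro i j
    rw [hpe i _ (hSV _ (hpS j)), hpe i _ (hpS j), ha i _ (hpS j).1]
  refine ⟨fun i ↦ d i - b i • V₂ (d i), fun i ↦ p i - a i • V₁ (p i), fun i j ↦ ?_⟩
  rw [inner_sub_smul_isometry (hdV i j) (hdV j i), inner_sub_smul_isometry (hpV i j) (hpV j i)]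
  have hsum : (inner ℂ (k i) (k j) : ℂ) = inner ℂ (d i) (d j) + inner ℂ (p i) (p j) +
      conj (f i) * f j * inner ℂ (k i) (k j) := by
    have h1 : ∀ i, e i = d i + p i + r i := fun i ↦ by simp only [hd]; abel
    have h2 : (inner ℂ (r i) (r j) : ℂ) = conj (f i) * f j * inner ℂ (k i) (k j) := by
      simp only [hr, J.inner_map_map, inner_smul_left, inner_smul_right]
      ring
    have h3 : (inner ℂ (p i) (d j) : ℂ) = 0 := by
      rw [← inner_conj_symm, hdS j _ (hpS i), map_zero]
    have h4 : (inner ℂ (d i) (r j) : ℂ) = 0 := hdH i _ (hfk j)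
    have h5 : (inner ℂ (r i) (d j) : ℂ) = 0 := hdH' j _ (hfk i)
    have h6 : (inner ℂ (p i) (r j) : ℂ) = 0 := hSJ' _ (hpS i) _ (hHL (hfk j))
    refine (hke i j).symm.trans ?_
    rw [h1 i, h1 j]
    simp only [inner_add_left, inner_add_right, h2, h3, h4, h5, h6, hdS i _ (hpS j),
      hrS i _ (hpS j)]
    ring
  linear_combination (-1 + conj (f i) * f j) * hkk i j +
    (1 - conj (a i) * a j) * (1 - conj (b i) * b j) * hsum

end Decomposition

end SymBidisc

namespace SymBidisc

open scoped ComplexConjugate InnerProductSpace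

/-! ### Square summable families, permutations and supports. -/

section SquareSummable

variable {ι : Type*}

/-- The isometry of `ℓ²(ι)` induced by a permutation of `ι`. -/
noncomputable def permute (σ : Equiv.Perm ι) :
    lp (fun _ : ι ↦ ℂ) 2 ≃ₗᵢ[ℂ] lp (fun _ : ι ↦ ℂ) 2 where
  toFun x := ⟨fun i ↦ x (σ.symm i), by
    refine memℓp_gen ?_
    exact (σ.symm.summable_iff (f := fun i ↦ ‖x i‖ ^ ENNReal.toReal 2)).2
      (lp.memℓp x |>.summable (by norm_num))⟩
  invFun x := ⟨fun i ↦ x (σ i), by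
    refine memℓp_gen ?_
    exact (σ.summable_iff (f := fun i ↦ ‖x i‖ ^ ENNReal.toReal 2)).2
      (lp.memℓp x |>.summable (by norm_num))⟩
  map_add' _ _ := rfl
  map_smul' _ _ := rfl
  left_inv x := by ext i; simp
  right_inv x := by ext i; simp
  norm_map' x := by
    rw [lp.norm_eq_tsum_rpow (by norm_num), lp.norm_eq_tsum_rpow (by norm_num)]
    congr 1
    exact σ.symm.tsum_eq fun i ↦ ‖x i‖ ^ ENNReal.toReal 2

lemma permute_apply (σ : Equiv.Perm ι) (x : lp (fun _ : ι ↦ ℂ) 2) (i : ι) :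
    permute σ x i = x (σ.symm i) := rfl

/-- The square summable families that vanish outside `s`. -/
noncomputable def supportedOn (s : Set ι) : Submodule ℂ (lp (fun _ : ι ↦ ℂ) 2) where
  carrier := {x | ∀ i ∉ s, x i = 0}
  add_mem' hx hy i hi := by rw [lp.coeFn_add, Pi.add_apply, hx i hi, hy i hi, add_zero]
  zero_mem' _ _ := rfl
  smul_mem' c x hx i hi := by rw [lp.coeFn_smul, Pi.smul_apply, hx i hi, smul_zero]

lemma mem_supportedOn {s : Set ι} {x : lp (fun _ : ι ↦ ℂ) 2} :
    x ∈ supportedOn s ↔ ∀ i ∉ s, x i = 0 := Iff.rfl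

lemma supportedOn_mono {s t : Set ι} (h : s ⊆ t) : supportedOn s ≤ supportedOn t :=
  fun _ hx i hi ↦ hx i fun his ↦ hi (h his)

lemma isClosed_supportedOn (s : Set ι) :
    IsClosed (supportedOn s : Set (lp (fun _ : ι ↦ ℂ) 2)) := by
  have : (supportedOn s : Set (lp (fun _ : ι ↦ ℂ) 2)) =
      ⋂ i ∈ sᶜ, {x | lp.evalCLM ℂ (fun _ : ι ↦ ℂ) 2 i x = 0} := by
    ext x
    simp only [SetLike.mem_coe, mem_supportedOn, Set.mem_iInter, Set.mem_compl_iff,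
      Set.mem_ofPred_eq]
    rfl
  rw [this]
  exact isClosed_biInter fun i _ ↦ isClosed_eq (by fun_prop) continuous_const

lemma permute_mem_supportedOn {σ : Equiv.Perm ι} {s t : Set ι} (h : ∀ i ∈ s, σ i ∈ t)
    {x : lp (fun _ : ι ↦ ℂ) 2} (hx : x ∈ supportedOn s) : permute σ x ∈ supportedOn t := by
  intro i hi
  rw [permute_apply]
  refine hx _ fun his ↦ hi ?_
  simpa using h _ his

lemma permute_symm_mem_supportedOn {σ : Equiv.Perm ι} {s t : Set ι} (h : ∀ i, σ i ∈ s → i ∈ t)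
    {x : lp (fun _ : ι ↦ ℂ) 2} (hx : x ∈ supportedOn s) : (permute σ).symm x ∈ supportedOn t :=
  fun i hi ↦ hx _ fun his ↦ hi (h i his)

lemma inner_eq_zero_of_supportedOn {s t : Set ι} (h : Disjoint s t) {x y : lp (fun _ : ι ↦ ℂ) 2}
    (hx : x ∈ supportedOn s) (hy : y ∈ supportedOn t) : (inner ℂ x y : ℂ) = 0 := by
  rw [lp.inner_eq_tsum]
  convert tsum_zero (L := .unconditional ι) with i
  by_cases hi : i ∈ s
  · rw [hy i (Set.disjoint_left.1 h hi), inner_zero_right]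
  · rw [hx i hi, inner_zero_left]

lemma apply_eq_zero_of_mem_orthogonal {s : Set ι} {x : lp (fun _ : ι ↦ ℂ) 2}
    (hx : x ∈ (supportedOn s)ᗮ) {i : ι} (hi : i ∈ s) : x i = 0 := by
  classical
  have h : lp.single 2 i (1 : ℂ) ∈ supportedOn s := by
    intro j hj
    rw [lp.single_apply_ne]
    rintro rfl
    exact hj hi
  have := hx _ h
  rwa [lp.inner_single_left, RCLike.inner_apply, map_one, mul_one] at this

end SquareSummable

/-! ### Shifts of ℤ² and the Szegő kernel. -/

section Lattice

/-- The lattice `ℤ²`, in an arbitrary universe. -/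
abbrev Lattice : Type u := ULift.{u} (ℤ × ℤ)

/-- The shift of the lattice in the first coordinate. -/
def shiftFst : Equiv.Perm Lattice.{u} where
  toFun i := ⟨(i.down.1 + 1, i.down.2)⟩
  invFun i := ⟨(i.down.1 - 1, i.down.2)⟩
  left_inv i := by simp
  right_inv i := by simp

/-- The shift of the lattice in the second coordinate. -/
def shiftSnd : Equiv.Perm Lattice.{u} where
  toFun i := ⟨(i.down.1, i.down.2 + 1)⟩
  invFun i := ⟨(i.down.1, i.down.2 - 1)⟩
  left_inv i := by simp
  right_inv i := by simp

/-- The quadrant of the lattice with both coordinates nonnegative. -/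
def quadrant : Set Lattice.{u} := {i | 0 ≤ i.down.1 ∧ 0 ≤ i.down.2}

/-- The half plane of the lattice with second coordinate nonnegative. -/
def halfPlane : Set Lattice.{u} := {i | 0 ≤ i.down.2}

lemma quadrant_subset_halfPlane : quadrant.{u} ⊆ halfPlane := fun _ hi ↦ hi.2

lemma shiftFst_mem_quadrant {i : Lattice.{u}} (hi : i ∈ quadrant) : shiftFst i ∈ quadrant :=
  ⟨by have := hi.1; simp only [shiftFst, Equiv.coe_fn_mk]; omega, hi.2⟩

lemma shiftSnd_mem_quadrant {i : Lattice.{u}} (hi : i ∈ quadrant) : shiftSnd i ∈ quadrant :=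
  ⟨hi.1, by have := hi.2; simp only [shiftSnd, Equiv.coe_fn_mk]; omega⟩

lemma shiftSnd_mem_halfPlane {i : Lattice.{u}} (hi : i ∈ halfPlane) : shiftSnd i ∈ halfPlane := by
  simp only [halfPlane, shiftSnd, Set.mem_ofPred_eq, Equiv.coe_fn_mk] at hi ⊢
  omega

lemma permute_comm (x : lp (fun _ : Lattice.{u} ↦ ℂ) 2) :
    permute shiftFst (permute shiftSnd x) = permute shiftSnd (permute shiftFst x) := rfl

/-- Here g₀ is the restriction of h to the row 0, and h' is the rest shifted back. Shifted families
of the half plane live on the rows from 1 on. -/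
lemma exists_permute_add {h : lp (fun _ : Lattice.{u} ↦ ℂ) 2} (hh : h ∈ supportedOn quadrant) :
    ∃ h' ∈ supportedOn quadrant, ∃ g₀ ∈ supportedOn quadrant, h = permute shiftSnd h' + g₀ ∧
      ∀ g ∈ supportedOn halfPlane, (inner ℂ g₀ (permute shiftSnd g) : ℂ) = 0 := by
  set r : Set Lattice.{u} := {i | 0 ≤ i.down.1 ∧ i.down.2 = 0} with hr
  have : CompleteSpace (supportedOn r) := (isClosed_supportedOn r).completeSpace_coe
  set g₀ := (supportedOn r).starProjection h with hg₀
  have hg₀r : g₀ ∈ supportedOn r := Submodule.starProjection_apply_mem _ _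
  have hsub : h - g₀ ∈ supportedOn {i : Lattice.{u} | 0 ≤ i.down.1 ∧ 1 ≤ i.down.2} := by
    intro i hi
    by_cases hir : i ∈ r
    · exact apply_eq_zero_of_mem_orthogonal (Submodule.sub_starProjection_mem_orthogonal h) hir
    · rw [lp.coeFn_sub, Pi.sub_apply, hg₀r i hir, hh i, sub_zero]
      simp only [hr, quadrant, Set.mem_ofPred_eq] at hi hir ⊢
      omega
  refine ⟨(permute shiftSnd).symm (h - g₀), permute_symm_mem_supportedOn (fun i hi ↦ ?_) hsub,
    g₀, supportedOn_mono (fun i hi ↦ ?_) hg₀r, ?_, fun g hg ↦ ?_⟩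
  · simp only [shiftSnd, quadrant, Set.mem_ofPred_eq, Equiv.coe_fn_mk] at hi ⊢
    omega
  · exact ⟨hi.1, hi.2.ge⟩
  · rw [LinearIsometryEquiv.apply_symm_apply, sub_add_cancel]
  · refine inner_eq_zero_of_supportedOn (t := {i : Lattice.{u} | 1 ≤ i.down.2})
      (Set.disjoint_left.2 fun i hi hi' ↦ ?_) hg₀r (permute_mem_supportedOn (fun i hi ↦ ?_) hg)
    · simp only [hr, Set.mem_ofPred_eq] at hi hi'
      omega
    · simp only [shiftSnd, halfPlane, Set.mem_ofPred_eq, Equiv.coe_fn_mk] at hi ⊢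
      omega

/-- The sequence of the powers of `a`, extended by zero to the negative integers. -/
noncomputable def geomSeq (a : ℂ) (n : ℤ) : ℂ := if 0 ≤ n then a ^ n.toNat else 0

lemma geomSeq_sub (a : ℂ) (n : ℤ) :
    geomSeq a n - a * geomSeq a (n - 1) = if n = 0 then 1 else 0 := by
  unfold geomSeq
  rcases lt_trichotomy n 0 with h | h | h
  · rw [if_neg (by omega), if_neg (by omega), if_neg (by omega)]
    ring
  · subst h
    simp
  · rw [if_pos (by omega), if_pos (by omega), if_neg (by omega),
      show n.toNat = (n - 1).toNat + 1 by omega]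
    ring

lemma summable_geomSeq {a b : ℂ} (ha : ‖a‖ < 1) (hb : ‖b‖ < 1) :
    Summable fun i : Lattice.{u} ↦
      ‖geomSeq a i.down.1 * geomSeq b i.down.2‖ ^ ENNReal.toReal 2 := by
  set φ : ℕ × ℕ → Lattice.{u} := fun p ↦ ⟨(p.1, p.2)⟩ with hφ
  have hinj : Function.Injective φ := by
    rintro ⟨m, n⟩ ⟨m', n'⟩ h
    simpa [hφ] using h
  rw [← hinj.summable_iff]
  · have h1 : Summable fun m : ℕ ↦ (‖a‖ ^ 2) ^ m :=
      summable_geometric_of_lt_one (by positivity) (by nlinarith [norm_nonneg a])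
    have h2 : Summable fun m : ℕ ↦ (‖b‖ ^ 2) ^ m :=
      summable_geometric_of_lt_one (by positivity) (by nlinarith [norm_nonneg b])
    convert h1.mul_of_nonneg h2 (fun _ ↦ by positivity) (fun _ ↦ by positivity) with p
    simp only [hφ, Function.comp_apply, geomSeq, Nat.cast_nonneg, if_true, Int.toNat_natCast,
      norm_mul, norm_pow, ENNReal.toReal_ofNat, Real.rpow_ofNat]
    ring
  · intro i hi
    have : ¬ (0 ≤ i.down.1 ∧ 0 ≤ i.down.2) := by
      rintro ⟨h1, h2⟩
      exact hi ⟨(i.down.1.toNat, i.down.2.toNat), by simp [hφ, h1, h2]⟩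
    rw [not_and_or] at this
    rcases this with h | h <;> simp [geomSeq, h]

/-- The Szegő kernel of the bidisc as an element of `ℓ²(ℤ²)`. -/
noncomputable def szego {a b : ℂ} (ha : ‖a‖ < 1) (hb : ‖b‖ < 1) :
    lp (fun _ : Lattice.{u} ↦ ℂ) 2 :=
  ⟨fun i ↦ geomSeq a i.down.1 * geomSeq b i.down.2, memℓp_gen (summable_geomSeq ha hb)⟩

section Szego

variable {a b : ℂ} (ha : ‖a‖ < 1) (hb : ‖b‖ < 1)

lemma szego_apply (i : Lattice.{u}) :
    szego ha hb i = geomSeq a i.down.1 * geomSeq b i.down.2 := rfl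

lemma szego_mem : szego.{u} ha hb ∈ supportedOn quadrant := by
  intro i hi
  rw [quadrant, Set.mem_ofPred_eq, not_and_or] at hi
  rw [szego_apply]
  rcases hi with h | h <;> simp [geomSeq, h]

lemma szego_sub_fst (i : Lattice.{u}) : (szego ha hb - a • permute shiftFst (szego ha hb)) i =
    (if i.down.1 = 0 then 1 else 0) * geomSeq b i.down.2 := by
  rw [← geomSeq_sub a]
  change geomSeq a i.down.1 * geomSeq b i.down.2 -
    a * (geomSeq a (i.down.1 - 1) * geomSeq b i.down.2) = _
  ring

lemma szego_sub_snd (i : Lattice.{u}) : (szego ha hb - b • permute shiftSnd (szego ha hb)) i =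
    geomSeq a i.down.1 * (if i.down.2 = 0 then 1 else 0) := by
  rw [← geomSeq_sub b]
  change geomSeq a i.down.1 * geomSeq b i.down.2 -
    b * (geomSeq a i.down.1 * geomSeq b (i.down.2 - 1)) = _
  ring

/-- With k the kernel, k - a U₁ k is supported on the column 0, where U₁ g vanishes. -/
lemma inner_szego_shiftFst {g : lp (fun _ : Lattice.{u} ↦ ℂ) 2} (hg : g ∈ supportedOn quadrant) :
    inner ℂ (szego ha hb) (permute shiftFst g) = conj a * inner ℂ (szego ha hb) g := by
  have h : (inner ℂ (szego ha hb - a • permute shiftFst (szego ha hb)) (permute shiftFst g) : ℂ)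
      = 0 := by
    refine inner_eq_zero_of_supportedOn (s := {i : Lattice.{u} | i.down.1 = 0})
      (t := {i : Lattice.{u} | 1 ≤ i.down.1}) (Set.disjoint_left.2 fun i hi hi' ↦ ?_)
      (fun i hi ↦ ?_) (permute_mem_supportedOn (fun i hi ↦ ?_) hg)
    · simp only [Set.mem_ofPred_eq] at hi hi'
      omega
    · rw [szego_sub_fst, if_neg (show ¬ i.down.1 = 0 from hi), zero_mul]
    · simp only [shiftFst, quadrant, Set.mem_ofPred_eq, Equiv.coe_fn_mk] at hi ⊢
      omega
  rwa [inner_sub_left, inner_smul_left, LinearIsometryEquiv.inner_map_map, sub_eq_zero] at h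

lemma inner_szego_shiftSnd {g : lp (fun _ : Lattice.{u} ↦ ℂ) 2} (hg : g ∈ supportedOn quadrant) :
    inner ℂ (szego ha hb) (permute shiftSnd g) = conj b * inner ℂ (szego ha hb) g := by
  have h : (inner ℂ (szego ha hb - b • permute shiftSnd (szego ha hb)) (permute shiftSnd g) : ℂ)
      = 0 := by
    refine inner_eq_zero_of_supportedOn (s := {i : Lattice.{u} | i.down.2 = 0})
      (t := {i : Lattice.{u} | 1 ≤ i.down.2}) (Set.disjoint_left.2 fun i hi hi' ↦ ?_)
      (fun i hi ↦ ?_) (permute_mem_supportedOn (fun i hi ↦ ?_) hg)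
    · simp only [Set.mem_ofPred_eq] at hi hi'
      omega
    · rw [szego_sub_snd, if_neg (show ¬ i.down.2 = 0 from hi), mul_zero]
    · simp only [shiftSnd, quadrant, Set.mem_ofPred_eq, Equiv.coe_fn_mk] at hi ⊢
      omega
  rwa [inner_sub_left, inner_smul_left, LinearIsometryEquiv.inner_map_map, sub_eq_zero] at h

/-- (1 - aU₁)(1 - bU₂) turns the kernel into the unit vector at the origin, whose pairing with any
Szegő kernel is 1; the shift relations pull out the two scalar factors. -/
lemma inner_szego_szego {a' b' : ℂ} (ha' : ‖a'‖ < 1) (hb' : ‖b'‖ < 1) :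
    (1 - conj a' * a) * (1 - conj b' * b) *
      inner ℂ (szego.{u} ha' hb') (szego.{u} ha hb) = 1 := by
  have hk := szego_mem.{u} ha hb
  set k := szego.{u} ha hb with hk_def
  set k' := szego.{u} ha' hb'
  set y := k - a • permute shiftFst k with hy
  have hy_mem : y ∈ supportedOn quadrant :=
    Submodule.sub_mem _ hk (Submodule.smul_mem _ _
      (permute_mem_supportedOn (fun _ ↦ shiftFst_mem_quadrant) hk))
  have h1 : inner ℂ k' y = (1 - conj a' * a) * inner ℂ k' k := by
    rw [hy, inner_sub_right, inner_smul_right, inner_szego_shiftFst ha' hb' hk]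
    ring
  have h2 : inner ℂ k' (y - b • permute shiftSnd y) = (1 - conj b' * b) * inner ℂ k' y := by
    rw [inner_sub_right, inner_smul_right, inner_szego_shiftSnd ha' hb' hy_mem]
    ring
  have h3 : ∀ i : Lattice.{u}, (y - b • permute shiftSnd y) i =
      (if i.down.1 = 0 then 1 else 0) * (if i.down.2 = 0 then 1 else 0) := by
    intro i
    change y i - b * y (shiftSnd.symm i) = _
    rw [szego_sub_fst, szego_sub_fst, ← geomSeq_sub b i.down.2]
    by_cases h : i.down.1 = 0 <;> simp [shiftSnd, h]
  have h4 : (inner ℂ k' (y - b • permute shiftSnd y) : ℂ) = 1 := by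
    rw [lp.inner_eq_tsum, tsum_eq_single (⟨(0, 0)⟩ : Lattice.{u})]
    · rw [h3, RCLike.inner_apply, szego_apply]
      simp [geomSeq]
    · intro i hi
      rw [h3]
      have : ¬ (i.down.1 = 0 ∧ i.down.2 = 0) := fun h ↦ hi (ULift.ext _ _ (Prod.ext h.1 h.2))
      rw [not_and_or] at this
      rcases this with h | h <;> simp [h]
  linear_combination h4 - h2 - (1 - conj b' * b) * h1

end Szego

end Lattice

end SymBidisc

namespace SymBidisc

open scoped ComplexConjugate InnerProductSpace
open MvPolynomial Filter Topology

/-! ### Von Neumann's inequality. -/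

section Gelfand

/-- Characters send unitaries to the unit circle, and the Gelfand transform is isometric. -/
lemma norm_aeval_le_of_commCStarAlgebra {A : Type*} [CommCStarAlgebra A] {u v : A}
    (hu : u ∈ unitary A) (hv : v ∈ unitary A) {P : MvPolynomial (Fin 2) ℂ} {C : ℝ} (hC : 0 ≤ C)
    (hP : ∀ z w : ℂ, ‖z‖ = 1 → ‖w‖ = 1 → ‖eval ![z, w] P‖ ≤ C) : ‖aeval ![u, v] P‖ ≤ C := by
  have hχ : ∀ (χ : WeakDual.characterSpace ℂ A) (a : A), a ∈ unitary A → ‖χ a‖ = 1 := by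
    intro χ a ha
    have h1 : conj (χ a) * χ a = 1 := by
      have h2 : χ (star a) = star (χ a) := map_star χ a
      rw [starRingEnd_apply, ← h2, ← map_mul, (Unitary.mem_iff.1 ha).1, map_one]
    rw [Complex.conj_mul'] at h1
    have h2 : ‖χ a‖ ^ 2 = 1 := by exact_mod_cast h1
    exact (pow_eq_one_iff_of_nonneg (norm_nonneg _) two_ne_zero).1 h2
  have h := (gelfandTransform_isometry A).norm_map_of_map_zero (map_zero _)
    (aeval ![u, v] P)
  rw [← h, ContinuousMap.norm_le _ hC]
  intro χ
  have e : WeakDual.gelfandTransform ℂ A (aeval ![u, v] P) χ = eval ![χ u, χ v] P := by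
    change (WeakDual.CharacterSpace.toAlgHom χ) (aeval ![u, v] P) = _
    rw [← AlgHom.comp_apply, comp_aeval, ← coe_aeval_eq_eval]
    refine congrArg (fun g : Fin 2 → ℂ ↦ aeval g P) (funext fun i ↦ ?_)
    fin_cases i <;> rfl
  rw [e]
  exact hP _ _ (hχ χ u hu) (hχ χ v hv)

/-- Von Neumann's inequality for a pair of commuting unitaries. -/
lemma exists_polynomial_calculus {B : Type*} [CStarAlgebra B] {u v : B}
    (hu : u ∈ unitary B) (hv : v ∈ unitary B) (huv : u * v = v * u) :
    ∃ ψ : MvPolynomial (Fin 2) ℂ →ₐ[ℂ] B, ψ (X 0) = u ∧ ψ (X 1) = v ∧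
      ∀ (P : MvPolynomial (Fin 2) ℂ) (C : ℝ), 0 ≤ C →
        (∀ z w : ℂ, ‖z‖ = 1 → ‖w‖ = 1 → ‖eval ![z, w] P‖ ≤ C) → ‖ψ P‖ ≤ C := by
  have huu := Unitary.mem_iff.1 hu
  have hvv := Unitary.mem_iff.1 hv
  have h1 : ∀ {a b : B}, a * star a = 1 → star a * a = 1 → a * b = b * a →
      star a * b = b * star a := by
    intro a b h h' hab
    calc star a * b = star a * b * (a * star a) := by rw [h, mul_one]
      _ = star a * (b * a) * star a := by noncomm_ring
      _ = (star a * a) * b * star a := by rw [← hab]; noncomm_ring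
      _ = b * star a := by rw [h', one_mul]
  have hcomm : ∀ a ∈ ({u, v} : Set B), ∀ b ∈ ({u, v} : Set B), a * b = b * a := by
    rintro a (rfl | rfl) b (rfl | rfl)
    exacts [rfl, huv, huv.symm, rfl]
  have hcomm' : ∀ a ∈ ({u, v} : Set B), ∀ b ∈ ({u, v} : Set B), a * star b = star b * a := by
    rintro a (rfl | rfl) b (rfl | rfl)
    exacts [huu.2.trans huu.1.symm, (h1 hvv.2 hvv.1 huv.symm).symm,
      (h1 huu.2 huu.1 huv).symm, hvv.2.trans hvv.1.symm]
  have hS := StarAlgebra.isMulCommutative_adjoin ℂ hcomm hcomm'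
  set S := (StarAlgebra.adjoin ℂ ({u, v} : Set B)).topologicalClosure with hSdef
  have hclosed : IsClosed (S : Set B) := StarSubalgebra.isClosed_topologicalClosure _
  have hmul : ∀ x y : S, x * y = y * x :=
    (StarSubalgebra.commRingTopologicalClosure (StarAlgebra.adjoin ℂ ({u, v} : Set B))
      fun x y ↦ mul_comm' x y).mul_comm
  let _ : CommCStarAlgebra S := { StarSubalgebra.cstarAlgebra S with mul_comm := hmul }
  have hmem : ∀ a ∈ ({u, v} : Set B), a ∈ S := fun a ha ↦
    StarSubalgebra.le_topologicalClosure _ (StarAlgebra.subset_adjoin ℂ _ ha)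
  set u' : S := ⟨u, hmem u (by simp)⟩
  set v' : S := ⟨v, hmem v (by simp)⟩
  have hu' : u' ∈ unitary S := Unitary.mem_iff.2 ⟨Subtype.ext huu.1, Subtype.ext huu.2⟩
  have hv' : v' ∈ unitary S := Unitary.mem_iff.2 ⟨Subtype.ext hvv.1, Subtype.ext hvv.2⟩
  refine ⟨S.toSubalgebra.val.comp (aeval ![u', v']), ?_, ?_, fun P C hC hP ↦ ?_⟩
  · rw [AlgHom.comp_apply, aeval_X]
    rfl
  · rw [AlgHom.comp_apply, aeval_X]
    rfl
  · exact norm_aeval_le_of_commCStarAlgebra hu' hv' hC hP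

end Gelfand

/-! ### Weak limits of contractions. -/

section WeakLimit

variable {E : Type*} [NormedAddCommGroup E] [InnerProductSpace ℂ E] [CompleteSpace E]

/-- A sequence of contractions converges weakly along an ultrafilter. -/
lemma exists_weak_limit (A : ℕ → E →L[ℂ] E) (hA : ∀ n, ‖A n‖ ≤ 1) (l : Ultrafilter ℕ) :
    ∃ M : E →L[ℂ] E, ‖M‖ ≤ 1 ∧
      ∀ x y, Tendsto (fun n ↦ (inner ℂ x (A n y) : ℂ)) l (𝓝 (inner ℂ x (M y))) := by
  have hbound : ∀ n x y, ‖(inner ℂ (A n x) y : ℂ)‖ ≤ ‖x‖ * ‖y‖ := by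
    intro n x y
    refine (norm_inner_le_norm _ _).trans ?_
    gcongr
    simpa using (A n).le_of_opNorm_le (hA n) x
  have hex : ∀ x y, ∃ c : ℂ, Tendsto (fun n ↦ (inner ℂ (A n x) y : ℂ)) l (𝓝 c) := by
    intro x y
    obtain ⟨c, -, hc⟩ := (isCompact_closedBall (0 : ℂ) (‖x‖ * ‖y‖)).ultrafilter_le_nhds'
      (l.map fun n ↦ (inner ℂ (A n x) y : ℂ))
      (Filter.mem_map.2 (Filter.univ_mem' fun n ↦ by simpa using hbound n x y))
    exact ⟨c, hc⟩
  choose B hB using hex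
  have hBu : ∀ {x y c}, Tendsto (fun n ↦ (inner ℂ (A n x) y : ℂ)) l (𝓝 c) → B x y = c :=
    fun h ↦ tendsto_nhds_unique (hB _ _) h
  have hBle : ∀ x y, ‖B x y‖ ≤ 1 * ‖x‖ * ‖y‖ := by
    intro x y
    rw [one_mul]
    exact le_of_tendsto (hB x y).norm (Eventually.of_forall fun n ↦ hbound n x y)
  set B' : E →L⋆[ℂ] E →L[ℂ] ℂ := LinearMap.mkContinuous₂ (LinearMap.mk₂'ₛₗ (starRingEnd ℂ)
    (RingHom.id ℂ) B
    (fun x x' y ↦ hBu (by simpa only [map_add, inner_add_left] using (hB x y).add (hB x' y)))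
    (fun c x y ↦ hBu (by
      simpa only [map_smul, inner_smul_left, smul_eq_mul] using (hB x y).const_mul (conj c)))
    (fun x y y' ↦ hBu (by simpa only [inner_add_right] using (hB x y).add (hB x y')))
    (fun c x y ↦ hBu (by
      simpa only [inner_smul_right, smul_eq_mul, RingHom.id_apply] using (hB x y).const_mul c))) 1 hBle
  have hlim : ∀ x y, (inner ℂ (InnerProductSpace.continuousLinearMapOfBilin B' x) y : ℂ) = B x y :=
    fun x y ↦ InnerProductSpace.continuousLinearMapOfBilin_apply B' x y
  refine ⟨InnerProductSpace.continuousLinearMapOfBilin B', ?_, fun x y ↦ ?_⟩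
  · refine ContinuousLinearMap.opNorm_le_bound _ zero_le_one fun x ↦ ?_
    set y := InnerProductSpace.continuousLinearMapOfBilin B' x with hy
    have h1 := hBle x y
    rw [← hlim, ← hy, inner_self_eq_norm_sq_to_K] at h1
    have h2 : ‖y‖ ^ 2 ≤ 1 * ‖x‖ * ‖y‖ := by simpa using h1
    by_contra! h3
    nlinarith [norm_nonneg x]
  · have h1 := (Complex.continuous_conj.tendsto _).comp (hB y x)
    rw [← hlim, inner_conj_symm] at h1
    refine h1.congr fun n ↦ ?_
    rw [Function.comp_apply, inner_conj_symm]

end WeakLimit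

/-! ### Polynomial approximation on the bidisc. -/

section Approximation

/-- Expand (z, w) = z(1, 0) + w(0, 1) by multilinearity; the finset records the slots that receive
(1, 0). -/
lemma exists_eval_eq_multilinear {n : ℕ} (q : (ℂ × ℂ) [×n]→L[ℂ] ℂ) :
    ∃ P : MvPolynomial (Fin 2) ℂ, ∀ z w : ℂ, eval ![z, w] P = q fun _ ↦ (z, w) := by
  refine ⟨∑ s : Finset (Fin n), C (q (s.piecewise (fun _ ↦ (1, 0)) fun _ ↦ (0, 1))) *
    (X 0 ^ s.card * X 1 ^ sᶜ.card), fun z w ↦ ?_⟩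
  have h : (fun _ : Fin n ↦ ((z, w) : ℂ × ℂ)) =
      (fun _ ↦ z • (1, 0)) + fun _ ↦ w • ((0, 1) : ℂ × ℂ) := by
    ext <;> simp
  rw [h, q.map_add_univ, map_sum]
  refine Finset.sum_congr rfl fun s _ ↦ ?_
  have h2 : s.piecewise (fun _ ↦ z • ((1, 0) : ℂ × ℂ)) (fun _ ↦ w • ((0, 1) : ℂ × ℂ)) =
      fun i ↦ (s.piecewise (fun _ ↦ z) fun _ ↦ w) i •
        s.piecewise (fun _ ↦ ((1, 0) : ℂ × ℂ)) (fun _ ↦ ((0, 1) : ℂ × ℂ)) i := by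
    ext i <;> by_cases hi : i ∈ s <;> simp [hi]
  rw [h2, q.map_smul_univ, Finset.prod_piecewise]
  simp [Finset.compl_eq_univ_sdiff, mul_comm]

/-- On each slice ζ ↦ f(ζv), ‖v‖ ≤ 1, Cauchy's estimate on a circle of radius ρ with r < ρ < 1
bounds the n-th homogeneous term at rv by (r/ρ)ⁿ. This is uniform in v, so a truncated power series
suffices. -/
lemma exists_polynomial_norm_sub_le {f : ℂ × ℂ → ℂ} (hf : AnalyticOnNhd ℂ f (Metric.ball 0 1))
    (hf1 : ∀ p ∈ Metric.ball (0 : ℂ × ℂ) 1, ‖f p‖ ≤ 1) {r ε : ℝ} (hr0 : 0 < r) (hr1 : r < 1)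
    (hε : 0 < ε) : ∃ P : MvPolynomial (Fin 2) ℂ, ∀ z w : ℂ, ‖z‖ ≤ 1 → ‖w‖ ≤ 1 →
      ‖eval ![z, w] P - f ((r : ℂ) • (z, w))‖ ≤ ε := by
  obtain ⟨ρ, hρ0, hρ1⟩ := exists_between hr1
  have hρ : 0 < ρ := hr0.trans hρ0
  obtain ⟨p, hp⟩ := hf 0 (Metric.mem_ball_self one_pos)
  choose Q hQ using fun n ↦ exists_eval_eq_multilinear (p n)
  have key : ∀ v : ℂ × ℂ, ‖v‖ ≤ 1 →
      (∀ n, ‖p n fun _ ↦ (r : ℂ) • v‖ ≤ 1 * (r / ρ) ^ n) ∧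
        HasSum (fun n ↦ p n fun _ ↦ (r : ℂ) • v) (f ((r : ℂ) • v)) := by
    intro v hv
    set g : ℂ → ℂ := fun ζ ↦ f (ζ • v) with hg
    have hmaps : ∀ ζ : ℂ, ‖ζ‖ < 1 → ζ • v ∈ Metric.ball (0 : ℂ × ℂ) 1 := by
      intro ζ hζ
      rw [mem_ball_zero_iff, norm_smul]
      nlinarith [norm_nonneg ζ, norm_nonneg v]
    have hdiff : DifferentiableOn ℂ g (Metric.closedBall 0 ρ) := by
      intro ζ hζ
      have h1 : ‖ζ‖ < 1 := (mem_closedBall_zero_iff.1 hζ).trans_lt hρ1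
      have h2 : DifferentiableAt ℂ f (ζ • v) := (hf _ (hmaps ζ h1)).differentiableAt
      exact (DifferentiableAt.comp ζ h2
        (differentiableAt_id.smul_const v)).differentiableWithinAt
    lift ρ to NNReal using hρ.le
    have hc := hdiff.hasFPowerSeriesOnBall (by exact_mod_cast hρ)
    set L : ℂ →L[ℂ] ℂ × ℂ := ContinuousLinearMap.toSpanSingleton ℂ v with hL
    have hp' : HasFPowerSeriesAt g (p.compContinuousLinearMap L) 0 := by
      have : HasFPowerSeriesAt f p (L 0) := by rwa [map_zero]
      exact this.compContinuousLinearMap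
    have hpc := hp'.eq_formalMultilinearSeries hc.hasFPowerSeriesAt
    have hcoef : ∀ n, (p n fun _ ↦ (r : ℂ) • v) =
        cauchyPowerSeries g 0 ρ n fun _ ↦ (r : ℂ) := by
      intro n
      rw [← hpc, FormalMultilinearSeries.compContinuousLinearMap_apply]
      rfl
    constructor
    · intro n
      rw [hcoef]
      refine ((cauchyPowerSeries g 0 ρ n).le_opNorm _).trans ?_
      have h1 := norm_cauchyPowerSeries_le g 0 ρ n
      have h2 : (2 * Real.pi)⁻¹ * ∫ θ in (0 : ℝ)..2 * Real.pi, ‖g (circleMap 0 ρ θ)‖ ≤ 1 := by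
        have h3 : ∫ θ in (0 : ℝ)..2 * Real.pi, ‖g (circleMap 0 ρ θ)‖ ≤ 1 * |2 * Real.pi - 0| := by
          refine (Real.le_norm_self _).trans (intervalIntegral.norm_integral_le_of_norm_le_const
            fun θ _ ↦ ?_)
          rw [norm_norm]
          refine hf1 _ (hmaps _ ?_)
          rw [norm_circleMap_zero, abs_of_pos hρ]
          exact hρ1
        rw [sub_zero, abs_of_pos Real.two_pi_pos, one_mul] at h3
        rw [inv_mul_le_iff₀ Real.two_pi_pos, mul_one]
        exact h3
      have h4 : ‖cauchyPowerSeries g 0 ρ n‖ ≤ 1 * (ρ : ℝ)⁻¹ ^ n := by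
        refine h1.trans ?_
        rw [abs_of_pos hρ]
        gcongr
      simp only [Finset.prod_const, Finset.card_univ, Fintype.card_fin, Complex.norm_real,
        Real.norm_of_nonneg hr0.le]
      calc _ ≤ 1 * (ρ : ℝ)⁻¹ ^ n * r ^ n := by gcongr
        _ = 1 * (r / ρ) ^ n := by rw [div_eq_mul_inv, mul_pow]; ring
    · have h1 := hc.hasSum (y := (r : ℂ)) (by
        rw [Metric.eball_coe, mem_ball_zero_iff, Complex.norm_real, Real.norm_of_nonneg hr0.le]
        exact hρ0)
      rw [zero_add] at h1
      simpa only [hcoef] using h1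
  have hlt : r / ρ < 1 := (div_lt_one hρ).2 hρ0
  have htend : Tendsto (fun n ↦ 1 * (r / ρ) ^ n / (1 - r / ρ)) atTop (𝓝 0) := by
    have := ((tendsto_pow_atTop_nhds_zero_of_lt_one (by positivity) hlt).const_mul 1).div_const
      (1 - r / ρ)
    simpa using this
  obtain ⟨N, hN⟩ := (htend.eventually_le_const hε).exists
  refine ⟨∑ n ∈ Finset.range N, (C (r : ℂ)) ^ n * Q n, fun z w hz hw ↦ ?_⟩
  obtain ⟨h1, h2⟩ := key (z, w) (by rw [Prod.norm_def]; exact max_le hz hw)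
  have h3 := norm_sub_le_of_geometric_bound_of_hasSum hlt h1 h2 N
  refine le_trans (le_of_eq ?_) (h3.trans hN)
  congr 2
  rw [map_sum]
  refine Finset.sum_congr rfl fun n _ ↦ ?_
  rw [map_mul, map_pow, eval_C, hQ, ContinuousMultilinearMap.map_smul_univ]
  simp

/-- A function in the Schur class of the bidisc is a pointwise limit of polynomials in it. -/
lemma exists_polynomial_tendsto {f : ℂ × ℂ → ℂ} (hf : AnalyticOnNhd ℂ f (Metric.ball 0 1))
    (hf1 : ∀ p ∈ Metric.ball (0 : ℂ × ℂ) 1, ‖f p‖ ≤ 1) :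
    ∃ P : ℕ → MvPolynomial (Fin 2) ℂ,
      (∀ n (z w : ℂ), ‖z‖ ≤ 1 → ‖w‖ ≤ 1 → ‖eval ![z, w] (P n)‖ ≤ 1) ∧
      ∀ z w : ℂ, ‖z‖ < 1 → ‖w‖ < 1 →
        Tendsto (fun n ↦ eval ![z, w] (P n)) atTop (𝓝 (f (z, w))) := by
  -- With n + 2, every εₙ is less than 1 and the dilation factor 1 - εₙ is positive. Dividing by 1 +
  -- εₙ restores the bound 1.
  set ε : ℕ → ℝ := fun n ↦ 1 / ((n : ℝ) + 2) with hε
  have hε0 : ∀ n, 0 < ε n := fun n ↦ by positivity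
  have hε1 : ∀ n, ε n < 1 := fun n ↦ by
    rw [hε, div_lt_one (by positivity)]
    linarith [Nat.cast_nonneg (α := ℝ) n]
  have hεt : Tendsto ε atTop (𝓝 0) :=
    tendsto_const_nhds.div_atTop (tendsto_atTop_add_const_right _ _ tendsto_natCast_atTop_atTop)
  choose Q hQ using fun n ↦ exists_polynomial_norm_sub_le hf hf1 (r := 1 - ε n) (ε := ε n)
    (by linarith [hε1 n]) (by linarith [hε0 n]) (hε0 n)
  have heval : ∀ n z w, eval ![z, w] (C ((1 + ε n : ℝ) : ℂ)⁻¹ * Q n) =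
      ((1 + ε n : ℝ) : ℂ)⁻¹ * eval ![z, w] (Q n) := fun n z w ↦ by rw [map_mul, eval_C]
  refine ⟨fun n ↦ C ((1 + ε n : ℝ) : ℂ)⁻¹ * Q n, fun n z w hz hw ↦ ?_, fun z w hz hw ↦ ?_⟩
  · have hpos : 0 < 1 + ε n := by linarith [hε0 n]
    have hmem : ((1 - ε n : ℝ) : ℂ) • (z, w) ∈ Metric.ball (0 : ℂ × ℂ) 1 := by
      rw [mem_ball_zero_iff, norm_smul, Complex.norm_real, Real.norm_of_nonneg
        (by linarith [hε1 n])]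
      have h1 : ‖(z, w)‖ ≤ 1 := by rw [Prod.norm_def]; exact max_le hz hw
      nlinarith [hε0 n, hε1 n, norm_nonneg (z, w)]
    have h2 : ‖eval ![z, w] (Q n)‖ ≤ 1 + ε n := by
      calc _ = ‖(eval ![z, w] (Q n) - f (((1 - ε n : ℝ) : ℂ) • (z, w))) +
            f (((1 - ε n : ℝ) : ℂ) • (z, w))‖ := by rw [sub_add_cancel]
        _ ≤ ε n + 1 := (norm_add_le _ _).trans (add_le_add (hQ n z w hz hw) (hf1 _ hmem))
        _ = 1 + ε n := add_comm _ _
    rw [heval, norm_mul, norm_inv, Complex.norm_real, Real.norm_of_nonneg hpos.le,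
      inv_mul_le_iff₀ hpos, mul_one]
    exact h2
  · have hmem : (z, w) ∈ Metric.ball (0 : ℂ × ℂ) 1 := by
      rw [mem_ball_zero_iff, Prod.norm_def]
      exact max_lt hz hw
    have h1 : Tendsto (fun n ↦ eval ![z, w] (Q n)) atTop (𝓝 (f (z, w))) := by
      have h2 : Tendsto (fun n ↦ f (((1 - ε n : ℝ) : ℂ) • (z, w))) atTop (𝓝 (f (z, w))) := by
        refine ((hf _ hmem).continuousAt.tendsto).comp ?_
        have h3 : Tendsto (fun n ↦ ((1 - ε n : ℝ) : ℂ)) atTop (𝓝 ((1 - 0 : ℝ) : ℂ)) :=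
          (Complex.continuous_ofReal.tendsto _).comp (tendsto_const_nhds.sub hεt)
        simpa using h3.smul_const (z, w)
      have h4 : Tendsto (fun n ↦ eval ![z, w] (Q n) - f (((1 - ε n : ℝ) : ℂ) • (z, w))) atTop
          (𝓝 0) := squeeze_zero_norm (fun n ↦ hQ n z w hz.le hw.le) hεt
      simpa using h4.add h2
    have h5 : Tendsto (fun n ↦ ((1 + ε n : ℝ) : ℂ)⁻¹) atTop (𝓝 1) := by
      have h6 : Tendsto (fun n ↦ ((1 + ε n : ℝ) : ℂ)) atTop (𝓝 ((1 + 0 : ℝ) : ℂ)) :=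
        (Complex.continuous_ofReal.tendsto _).comp (tendsto_const_nhds.add hεt)
      simpa using h6.inv₀ (by simp)
    simp only [heval]
    simpa using h5.mul h1

end Approximation

end SymBidisc

namespace SymBidisc

open scoped ComplexConjugate InnerProductSpace
open MvPolynomial Filter Topology

/-! ### The multiplier of a Schur function. -/

section Multiplier

lemma eval_map_conj (P : MvPolynomial (Fin 2) ℂ) (z w : ℂ) :
    eval ![conj z, conj w] (map (starRingEnd ℂ) P) = conj (eval ![z, w] P) := by
  rw [eval_map, eval, coe_eval₂Hom, eval₂_comp_left (starRingEnd ℂ)]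
  congr 1
  ext i
  fin_cases i <;> rfl

variable {E : Type*} [NormedAddCommGroup E] [InnerProductSpace ℂ E] [CompleteSpace E]

lemma coe_linearIsometryEquiv_mem_unitary (U : E ≃ₗᵢ[ℂ] E) :
    (U : E →L[ℂ] E) ∈ unitary (E →L[ℂ] E) :=
  (Unitary.linearIsometryEquiv.symm U).2

/-- The operator `f^∨(U₁, U₂)` for a function `f` in the Schur class of the bidisc and commuting
unitaries `U₁` and `U₂`, where `f^∨(z) = conj (f (conj z))`. -/
lemma exists_multiplier {U₁ U₂ : E ≃ₗᵢ[ℂ] E} (hU : ∀ x, U₁ (U₂ x) = U₂ (U₁ x)) {f : ℂ × ℂ → ℂ}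
    (hf : AnalyticOnNhd ℂ f (Metric.ball 0 1)) (hf1 : ∀ p ∈ Metric.ball (0 : ℂ × ℂ) 1, ‖f p‖ ≤ 1) :
    ∃ M : E →L[ℂ] E, ‖M‖ ≤ 1 ∧ (∀ x, M (U₁ x) = U₁ (M x)) ∧ (∀ x, M (U₂ x) = U₂ (M x)) ∧
      (∀ X : Submodule ℂ E, IsClosed (X : Set E) → (∀ x ∈ X, U₁ x ∈ X) → (∀ x ∈ X, U₂ x ∈ X) →
        ∀ x ∈ X, M x ∈ X) ∧
      ∀ X : Submodule ℂ E, (∀ x ∈ X, U₁ x ∈ X) → (∀ x ∈ X, U₂ x ∈ X) →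
        ∀ (k : E) (a b : ℂ), ‖a‖ < 1 → ‖b‖ < 1 →
          (∀ x ∈ X, inner ℂ k (U₁ x) = conj a * inner ℂ k x) →
          (∀ x ∈ X, inner ℂ k (U₂ x) = conj b * inner ℂ k x) →
            ∀ x ∈ X, inner ℂ k (M x) = conj (f (a, b)) * inner ℂ k x := by
  obtain ⟨ψ, hψ₁, hψ₂, hψ⟩ := exists_polynomial_calculus (coe_linearIsometryEquiv_mem_unitary U₁)
    (coe_linearIsometryEquiv_mem_unitary U₂) (ContinuousLinearMap.ext hU)
  have hψX₁ : ∀ P x, ψ (P * X 0) x = ψ P (U₁ x) := fun P x ↦ by rw [map_mul, hψ₁]; rfl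
  have hψX₂ : ∀ P x, ψ (P * X 1) x = ψ P (U₂ x) := fun P x ↦ by rw [map_mul, hψ₂]; rfl
  have hψX₁' : ∀ P x, ψ (P * X 0) x = U₁ (ψ P x) := fun P x ↦ by
    rw [mul_comm, map_mul, hψ₁]; rfl
  have hψX₂' : ∀ P x, ψ (P * X 1) x = U₂ (ψ P x) := fun P x ↦ by
    rw [mul_comm, map_mul, hψ₂]; rfl
  have hψC : ∀ c x, ψ (C c) x = c • x := by
    intro c x
    rw [← algebraMap_eq, AlgHom.commutes, Algebra.algebraMap_eq_smul_one]
    rfl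
  have hψmem : ∀ X : Submodule ℂ E, (∀ x ∈ X, U₁ x ∈ X) → (∀ x ∈ X, U₂ x ∈ X) →
      ∀ P, ∀ x ∈ X, ψ P x ∈ X := by
    intro Y h₁ h₂ P
    induction P using MvPolynomial.induction_on with
    | C c => exact fun x hx ↦ by rw [hψC]; exact Y.smul_mem _ hx
    | add P Q hP hQ => exact fun x hx ↦ by rw [map_add]; exact Y.add_mem (hP x hx) (hQ x hx)
    | mul_X P i hP =>
      intro x hx
      fin_cases i
      · exact (hψX₁ P x) ▸ hP _ (h₁ x hx)
      · exact (hψX₂ P x) ▸ hP _ (h₂ x hx)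
  -- Pairing with k acts as evaluation at (conj a, conj b); conjugating the coefficients of P
  -- therefore gives conj P(a, b).
  have hψk : ∀ Y : Submodule ℂ E, (∀ x ∈ Y, U₁ x ∈ Y) → (∀ x ∈ Y, U₂ x ∈ Y) →
      ∀ (k : E) (a b : ℂ), (∀ x ∈ Y, inner ℂ k (U₁ x) = conj a * inner ℂ k x) →
        (∀ x ∈ Y, inner ℂ k (U₂ x) = conj b * inner ℂ k x) → ∀ P, ∀ x ∈ Y,
          inner ℂ k (ψ (map (starRingEnd ℂ) P) x) = conj (eval ![a, b] P) * inner ℂ k x := by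
    intro Y h₁ h₂ k a b ha hb P
    induction P using MvPolynomial.induction_on with
    | C c => exact fun x hx ↦ by rw [map_C, hψC, inner_smul_right, eval_C]
    | add P Q hP hQ =>
      exact fun x hx ↦ by
        rw [map_add, map_add, map_add, map_add, add_apply, inner_add_right, hP x hx, hQ x hx]
        ring
    | mul_X P i hP =>
      intro x hx
      fin_cases i
      · change inner ℂ k (ψ (map (starRingEnd ℂ) (P * X 0)) x) =
          conj (eval ![a, b] (P * X 0)) * inner ℂ k x
        rw [map_mul, map_X, hψX₁, hP _ (h₁ x hx), ha x hx, map_mul, eval_X, map_mul]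
        simp only [Matrix.cons_val_zero]
        ring
      · change inner ℂ k (ψ (map (starRingEnd ℂ) (P * X 1)) x) =
          conj (eval ![a, b] (P * X 1)) * inner ℂ k x
        rw [map_mul, map_X, hψX₂, hP _ (h₂ x hx), hb x hx, map_mul, eval_X, map_mul]
        simp only [Matrix.cons_val_one, Matrix.cons_val_fin_one]
        ring
  obtain ⟨P, hP1, hPf⟩ := exists_polynomial_tendsto hf hf1
  set A : ℕ → E →L[ℂ] E := fun n ↦ ψ (map (starRingEnd ℂ) (P n)) with hA
  have hA1 : ∀ n, ‖A n‖ ≤ 1 := by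
    intro n
    refine hψ _ 1 zero_le_one fun z w hz hw ↦ ?_
    rw [← Complex.conj_conj z, ← Complex.conj_conj w, eval_map_conj, RCLike.norm_conj]
    exact hP1 n _ _ (by rw [RCLike.norm_conj, hz]) (by rw [RCLike.norm_conj, hw])
  obtain ⟨M, hM1, hM⟩ := exists_weak_limit A hA1 (Filter.hyperfilter ℕ)
  have hcomm : ∀ U : E ≃ₗᵢ[ℂ] E, (∀ n x, A n (U x) = U (A n x)) → ∀ x, M (U x) = U (M x) := by
    intro U h x
    refine ext_inner_left ℂ fun y ↦ ?_
    obtain ⟨y, rfl⟩ := U.surjective y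
    refine tendsto_nhds_unique (hM _ _) ?_
    simp only [h, LinearIsometryEquiv.inner_map_map]
    exact hM y x
  refine ⟨M, hM1, hcomm U₁ fun n x ↦ by rw [hA, ← hψX₁, hψX₁'],
    hcomm U₂ fun n x ↦ by rw [hA, ← hψX₂, hψX₂'], fun Y hY h₁ h₂ x hx ↦ ?_,
    fun Y h₁ h₂ k a b ha1 hb1 ha hb x hx ↦ ?_⟩
  -- A closed subspace is its own double orthogonal complement, hence weakly closed.
  · rw [← hY.submodule_topologicalClosure_eq, ← Submodule.orthogonal_orthogonal_eq_closure]
    intro y hy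
    refine tendsto_nhds_unique (hM y x) ?_
    simp only [Submodule.inner_left_of_mem_orthogonal (hψmem Y h₁ h₂ _ x hx) hy, hA]
    exact tendsto_const_nhds
  · refine tendsto_nhds_unique (hM k x) ?_
    simp only [hA, hψk Y h₁ h₂ k a b ha hb _ x hx]
    refine Tendsto.mul_const _ ((Complex.continuous_conj.tendsto _).comp ?_)
    exact (hPf a b ha1 hb1).mono_left Nat.hyperfilter_le_atTop

end Multiplier

/-! ### Agler's theorem on the bidisc. -/

section Bidisc

/-- The diagonal action of an isometry on a Hilbert sum. -/
noncomputable def diagonalIsometry {E : Type*} [NormedAddCommGroup E] [InnerProductSpace ℂ E]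
    (U : E ≃ₗᵢ[ℂ] E) : WithLp 2 (E × E) →ₗᵢ[ℂ] WithLp 2 (E × E) where
  toFun x := WithLp.toLp 2 (U x.fst, U x.snd)
  map_add' x y := by
    rw [WithLp.add_fst, WithLp.add_snd, map_add, map_add]
    rfl
  map_smul' c x := by
    rw [WithLp.smul_fst, WithLp.smul_snd, map_smul, map_smul]
    rfl
  norm_map' x := by
    rw [← sq_eq_sq₀ (norm_nonneg _) (norm_nonneg _), WithLp.prod_norm_sq_eq_of_L2,
      WithLp.prod_norm_sq_eq_of_L2]
    simp

/-- A contraction `M` is dilated to the isometry `(M, (1 - M* M)^{1/2})`, which intertwines the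
unitaries that commute with `M`. -/
lemma exists_isometry_of_contraction {E : Type*} [NormedAddCommGroup E] [InnerProductSpace ℂ E]
    [CompleteSpace E] {M : E →L[ℂ] E} (hM : ‖M‖ ≤ 1) :
    ∃ J : E →ₗᵢ[ℂ] WithLp 2 (E × E), (∀ x, (J x).fst = M x) ∧
      ∀ U : E ≃ₗᵢ[ℂ] E, (∀ x, M (U x) = U (M x)) → ∀ x, J (U x) = diagonalIsometry U (J x) := by
  have hpos : 0 ≤ 1 - star M * M := by
    rw [sub_nonneg, ← CStarAlgebra.norm_le_one_iff_of_nonneg _ (star_mul_self_nonneg M),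
      CStarRing.norm_star_mul_self]
    exact mul_le_one₀ hM (norm_nonneg _) hM
  set D := CFC.sqrt (1 - star M * M) with hD
  have hDD : star D * D = 1 - star M * M := by
    rw [(CFC.sqrt_nonneg (1 - star M * M)).isSelfAdjoint.star_eq, CFC.sqrt_mul_sqrt_self _ hpos]
  let J : E →ₗᵢ[ℂ] WithLp 2 (E × E) :=
    { toFun := fun x ↦ WithLp.toLp 2 (M x, D x)
      map_add' := fun x y ↦ by simp [← WithLp.toLp_add]
      map_smul' := fun c x ↦ by simp [← WithLp.toLp_smul]
      norm_map' := fun x ↦ by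
        rw [← sq_eq_sq₀ (norm_nonneg _) (norm_nonneg _)]
        change ‖WithLp.toLp 2 (M x, D x)‖ ^ 2 = _
        rw [WithLp.prod_norm_sq_eq_of_L2]
        have h1 : (inner ℂ x ((star D * D) x) : ℂ) = inner ℂ x ((1 - star M * M) x) := by rw [hDD]
        have h2 : (inner ℂ (D x) (D x) : ℂ) = inner ℂ x x - inner ℂ (M x) (M x) := by
          simpa [ContinuousLinearMap.star_eq_adjoint, inner_sub_right,
            ContinuousLinearMap.adjoint_inner_right] using h1
        simp only [inner_self_eq_norm_sq_to_K] at h2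
        have h3 : ‖D x‖ ^ 2 = ‖x‖ ^ 2 - ‖M x‖ ^ 2 := by
          exact Complex.ofReal_injective (by push_cast; exact h2)
        simp [h3] }
  refine ⟨J, fun _ ↦ rfl, fun U hU x ↦ ?_⟩
  have hu := coe_linearIsometryEquiv_mem_unitary U
  have hMU : M * (U : E →L[ℂ] E) = U * M := ContinuousLinearMap.ext hU
  set V : E →L[ℂ] E := (U : E →L[ℂ] E) with hV
  have hVV := Unitary.mem_iff.1 hu
  have h1 : star M * V = V * star M := by
    calc star M * V = (V * star V) * star M * V := by rw [hVV.2, one_mul]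
      _ = V * star (M * V) * V := by rw [star_mul]; noncomm_ring
      _ = V * star M * (star V * V) := by rw [hMU, star_mul]; noncomm_ring
      _ = V * star M := by rw [hVV.1, mul_one]
  have h2 : Commute (1 - star M * M) V := by
    refine (Commute.one_left _).sub_left ?_
    exact Commute.mul_left h1 hMU
  have h3 : D * V = V * D := h2.cfcₙ_nnreal NNReal.sqrt
  have h4 : D (U x) = U (D x) := DFunLike.congr_fun h3 x
  change WithLp.toLp 2 (M (U x), D (U x)) = WithLp.toLp 2 (U (M x), U (D x))
  rw [hU, h4]

/-- **Agler's theorem** on the bidisc. -/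
lemma exists_agler_decomposition {f : ℂ × ℂ → ℂ} (hf : AnalyticOnNhd ℂ f (Metric.ball 0 1))
    (hf1 : ∀ p ∈ Metric.ball (0 : ℂ × ℂ) 1, ‖f p‖ ≤ 1) :
    ∃ (K : Type u) (_ : NormedAddCommGroup K) (_ : InnerProductSpace ℂ K) (_ : CompleteSpace K)
      (v₁ v₂ : {p : ℂ × ℂ // ‖p.1‖ < 1 ∧ ‖p.2‖ < 1} → K), ∀ i j : {p : ℂ × ℂ // ‖p.1‖ < 1 ∧ ‖p.2‖ < 1},
        1 - conj (f i) * f j = (1 - conj i.1.1 * j.1.1) * inner ℂ (v₁ i) (v₁ j) +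
          (1 - conj i.1.2 * j.1.2) * inner ℂ (v₂ i) (v₂ j) := by
  obtain ⟨M, hM1, hM₁, hM₂, hMX, hMk⟩ := exists_multiplier
    (U₁ := permute shiftFst.{u}) (U₂ := permute shiftSnd) permute_comm hf hf1
  obtain ⟨J, hJ, hJU⟩ := exists_isometry_of_contraction hM1
  set E := lp (fun _ : Lattice.{u} ↦ ℂ) 2
  set H : Submodule ℂ E := supportedOn quadrant with hH
  set L : Submodule ℂ E := supportedOn halfPlane with hL
  have hH₁ : ∀ x ∈ H, permute shiftFst x ∈ H := fun x ↦
    permute_mem_supportedOn fun _ ↦ shiftFst_mem_quadrant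
  have hH₂ : ∀ x ∈ H, permute shiftSnd x ∈ H := fun x ↦
    permute_mem_supportedOn fun _ ↦ shiftSnd_mem_quadrant
  have hL₁ : ∀ x ∈ L, permute shiftFst x ∈ L := fun x ↦
    permute_mem_supportedOn (s := halfPlane) (t := halfPlane) fun _ hi ↦ hi
  have hL₂ : ∀ x ∈ L, permute shiftSnd x ∈ L := fun x ↦
    permute_mem_supportedOn fun _ ↦ shiftSnd_mem_halfPlane
  have hHL : H ≤ L := supportedOn_mono quadrant_subset_halfPlane
  have hMH : ∀ x ∈ H, M x ∈ H := hMX H (isClosed_supportedOn _) hH₁ hH₂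
  have hML : ∀ x ∈ L, M x ∈ L := hMX L (isClosed_supportedOn _) hL₁ hL₂
  set X : Submodule ℂ (WithLp 2 (E × E)) := H.comap (WithLp.fstL 2 ℂ E E).toLinearMap with hX
  have hmemX : ∀ x, x ∈ X ↔ x.fst ∈ H := fun _ ↦ Iff.rfl
  have hXorth : ∀ q : WithLp 2 (E × E), q ∈ Xᗮ ↔ q.fst ∈ Hᗮ ∧ q.snd = 0 := by
    intro q
    constructor
    · intro hq
      constructor
      · intro h hh
        have := hq (WithLp.toLp 2 (h, 0)) hh
        simpa [WithLp.prod_inner_apply] using this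
      · have := hq (WithLp.toLp 2 (0, q.snd)) H.zero_mem
        rw [WithLp.prod_inner_apply, inner_zero_left, zero_add] at this
        exact inner_self_eq_zero.1 this
    · rintro ⟨h1, h2⟩ x hx
      change (inner ℂ x.fst q.fst : ℂ) + inner ℂ x.snd q.snd = 0
      rw [h1 x.fst hx, h2, inner_zero_right, add_zero]
  have hkey := exists_decomposition (H := H) (L := L) (X := X)
    ((isClosed_supportedOn quadrant).preimage (WithLp.fstL 2 ℂ E E).continuous)
    (U₁ := (permute shiftFst : E ≃ₗᵢ[ℂ] E)) (U₂ := (permute shiftSnd : E ≃ₗᵢ[ℂ] E))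
    (V₁ := diagonalIsometry (permute shiftFst)) (V₂ := diagonalIsometry (permute shiftSnd))
    (J := J) hHL
    (fun g hg ↦ ⟨(permute shiftFst).symm g, permute_symm_mem_supportedOn
      (s := halfPlane) (t := halfPlane) (fun _ hi ↦ hi) hg,
      (permute shiftFst).apply_symm_apply g⟩)
    hL₂ (fun h hh ↦ exists_permute_add hh) (hJU _ hM₁) (hJU _ hM₂)
    (fun h hh ↦ by rw [hmemX, hJ]; exact hMH h hh) (fun x hx ↦ hH₁ _ hx)
    (fun g hg q hq hgq ↦ by
      rw [hXorth] at hq ⊢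
      rw [hmemX, WithLp.sub_fst, hJ] at hgq
      refine ⟨?_, ?_⟩
      -- The first component of q lives on the half plane off the quadrant, so on negative columns,
      -- which U₂ preserves. For all of Hᗮ this would fail: U₂ moves the row -1 into the row 0.
      · have hqL : q.fst ∈ L := by
          rw [← sub_sub_cancel (M g) q.fst]
          exact L.sub_mem (hML g hg) (hHL hgq)
        have hqs : q.fst ∈ supportedOn {i : Lattice.{u} | i.down.1 < 0} := by
          intro i hi
          by_cases hi' : i ∈ quadrant
          · exact apply_eq_zero_of_mem_orthogonal hq.1 hi'
          · refine hqL i fun h ↦ hi' ⟨?_, h⟩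
            simpa using hi
        intro h hh
        refine inner_eq_zero_of_supportedOn (t := {i : Lattice.{u} | i.down.1 < 0})
          (Set.disjoint_left.2 fun i hi hi' ↦ ?_) hh (permute_mem_supportedOn (fun i hi ↦ hi) hqs)
        exact absurd hi.1 (not_le.2 hi')
      · change permute shiftSnd q.snd = 0
        rw [hq.2, map_zero])
    (ι := {p : ℂ × ℂ // ‖p.1‖ < 1 ∧ ‖p.2‖ < 1})
    (e := fun i ↦ WithLp.toLp 2 (szego i.2.1 i.2.2, 0)) (k := fun i ↦ szego i.2.1 i.2.2)
    (a := fun i ↦ i.1.1) (b := fun i ↦ i.1.2) (f := fun i ↦ f i)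
    (fun i ↦ szego_mem i.2.1 i.2.2)
    (fun i x hx ↦ by
      simp only [WithLp.prod_inner_apply, inner_zero_left, add_zero]
      exact inner_szego_shiftFst i.2.1 i.2.2 hx)
    (fun i x hx ↦ by
      simp only [WithLp.prod_inner_apply, inner_zero_left, add_zero]
      exact inner_szego_shiftSnd i.2.1 i.2.2 hx)
    (fun i ↦ szego_mem i.2.1 i.2.2)
    (fun i h hh ↦ by
      simp only [WithLp.prod_inner_apply, inner_zero_left, add_zero]
      refine Eq.trans ?_ (hMk H hH₁ hH₂ _ i.1.1 i.1.2 i.2.1 i.2.2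
        (fun x hx ↦ inner_szego_shiftFst i.2.1 i.2.2 hx)
        (fun x hx ↦ inner_szego_shiftSnd i.2.1 i.2.2 hx) h hh)
      rw [← hJ]
      rfl)
    (fun i j ↦ by simp [WithLp.prod_inner_apply])
    (fun i j ↦ inner_szego_szego j.2.1 j.2.2 i.2.1 i.2.2)
  exact ⟨WithLp 2 (E × E), _, _, inferInstance, hkey⟩

end Bidisc

/-! ### Symmetrization and conclusion. -/

lemma hasUnitaryGModel_of_mem_schurClass {φ : ℂ × ℂ → ℂ} (hφ : φ ∈ SchurClass) :
    HasUnitaryGModel.{u} φ := by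
  have hmem : ∀ p ∈ Metric.ball (0 : ℂ × ℂ) 1, (p.1 + p.2, p.1 * p.2) ∈ G := by
    intro p hp
    rw [mem_ball_zero_iff] at hp
    exact ⟨p.1, p.2, (norm_fst_le p).trans_lt hp, (norm_snd_le p).trans_lt hp, rfl⟩
  obtain ⟨K, _, _, _, v₁, v₂, h⟩ := exists_agler_decomposition.{u}
    (f := fun p ↦ φ (p.1 + p.2, p.1 * p.2))
    (fun p hp ↦ AnalyticAt.fun_comp (hφ.1 _ (hmem p hp))
      ((analyticAt_fst.add analyticAt_snd).prod (analyticAt_fst.mul analyticAt_snd)))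
    (fun p hp ↦ hφ.2 _ (hmem p hp))
  classical
  -- Taking v₂ at the swapped point makes v(z, w) and v(w, z) collect the two terms of the average
  -- of the decomposition and its swap; √2/2 supplies the weight 1/2.
  let v : ℂ → ℂ → WithLp 2 (K × K) := fun z w ↦
    if h : ‖z‖ < 1 ∧ ‖w‖ < 1 then
      ((√2 : ℝ) / 2 : ℂ) • WithLp.toLp 2 (v₁ ⟨(z, w), h⟩, v₂ ⟨(w, z), h.symm⟩)
    else 0
  have hc : conj ((√2 : ℝ) / 2 : ℂ) * ((√2 : ℝ) / 2 : ℂ) = 1 / 2 := by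
    rw [map_div₀, Complex.conj_ofReal, map_ofNat, div_mul_div_comm, ← Complex.ofReal_mul,
      Real.mul_self_sqrt (by norm_num)]
    norm_num
  refine hasUnitaryGModel_of_decomposition (v := v) fun z w z' w' hz hw hz' hw' ↦ ?_
  have h1 := h ⟨(z', w'), hz', hw'⟩ ⟨(z, w), hz, hw⟩
  have h2 := h ⟨(w', z'), hw', hz'⟩ ⟨(w, z), hw, hz⟩
  simp only [add_comm w' z', mul_comm w' z', add_comm w z, mul_comm w z] at h2
  have e1 : v z w = ((√2 : ℝ) / 2 : ℂ) • WithLp.toLp 2 (v₁ ⟨(z, w), hz, hw⟩, v₂ ⟨(w, z), hw, hz⟩) :=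
    dif_pos ⟨hz, hw⟩
  have e2 : v w z = ((√2 : ℝ) / 2 : ℂ) • WithLp.toLp 2 (v₁ ⟨(w, z), hw, hz⟩, v₂ ⟨(z, w), hz, hw⟩) :=
    dif_pos ⟨hw, hz⟩
  have e3 : v z' w' =
      ((√2 : ℝ) / 2 : ℂ) • WithLp.toLp 2 (v₁ ⟨(z', w'), hz', hw'⟩, v₂ ⟨(w', z'), hw', hz'⟩) :=
    dif_pos ⟨hz', hw'⟩
  have e4 : v w' z' =
      ((√2 : ℝ) / 2 : ℂ) • WithLp.toLp 2 (v₁ ⟨(w', z'), hw', hz'⟩, v₂ ⟨(z', w'), hz', hw'⟩) :=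
    dif_pos ⟨hw', hz'⟩
  rw [e1, e2, e3, e4, inner_smul_left, inner_smul_right, inner_smul_left, inner_smul_right,
    ← mul_assoc (conj _), ← mul_assoc (conj _), hc, WithLp.prod_inner_apply,
    WithLp.prod_inner_apply]
  simp only at h1 h2 ⊢
  linear_combination (1 / 2) * h1 + (1 / 2) * h2

end SymBidisc

theorem theorem4p1 (φ : ℂ × ℂ → ℂ) :
    List.TFAE [φ ∈ SymBidisc.SchurClass, SymBidisc.HasGModel.{u} φ,
      SymBidisc.HasUnitaryGModel.{u} φ] := by
  tfae_have 1 → 3 := SymBidisc.hasUnitaryGModel_of_mem_schurClass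
  tfae_have 3 → 2 := fun ⟨M, i₁, i₂, i₃, T, u, h, _⟩ ↦ ⟨M, i₁, i₂, i₃, T, u, h⟩
  tfae_have 2 → 1 := SymBidisc.HasGModel.mem_schurClass
  tfae_finish
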